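/- Let $M$ be a connected (Hausdorff, second countable) $C^\infty$ manifold of dimension $n\ge 2$, $\pi:TM\to M$ its tangent bundle and $T_0M=TM\setminus\{0\}$ the tangent bundle without the zero section. Let $J=\frac{\partial}{\partial y^i}\otimes dx^i$ be the tangent structure and $\mathbb C=y^i\frac{\partial}{\partial y^i}$ the Liouville vector field. For a function $f$ and a field of endomorphisms $K$ of $T(T_0M)$ write $d_Kf=df\circ K$, and $(\mathcal L_XK)(Y)=[X,KY]-K[X,Y]$. A spray is a smooth vector field $S$ on $T_0M$ with $JS=\mathbb C$ and $[\mathbb C,S]=S$. It defines the projectors $h=\frac12(\mathrm{Id}-\mathcal L_SJ)$, $v=\frac12(\mathrm{Id}+\mathcal L_SJ)$ and the Jacobi endomorphism $\Phi=v\circ\mathcal L_Sh$, which locally has the form $\Phi=R^i_j\frac{\partial}{\partial y^i}\otimes dx^j$; its Ricci curvature $\mathrm{Ric}=\operatorname{Tr}\Phi=R^i_i$ and its Ricci scalar $R$ are related by $\operatorname{Tr}\Phi=(n-1)R$. A Finsler function is a continuous function $F:TM\to\mathbb R$ that is smooth and strictly positive on $T_0M$, satisfies $F(x,\lambda y)=\lambda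 F(x,y)$ for all $\lambda\ge 0$, and whose metric tensor $g_{ij}=\frac12\frac{\partial^2F^2}{\partial y^i\partial y^j}$ has rank $n$ on $T_0M$. The spray $S$ is metrizable by $F$ if $i_S\,dd_JF^2=-dF^2$ on $T_0M$. In that case $F$ has constant flag curvature $\kappa\in\mathbb R$ if $\Phi=\kappa\,(F^2J-F\,d_JF\otimes\mathbb C)$ on $T_0M$. **Theorem 4.1.** Let $S$ be a spray whose Ricci curvature vanishes nowhere on $T_0M$. Then $S$ is metrizable by a Finsler function of non-zero constant flag curvature if and only if the following three conditions hold on $T_0M$: - (A) $\operatorname{rank} dd_J(\operatorname{Tr}\Phi)=2n$; - (D1) $2(n-1)\Phi-2(\operatorname{Tr}\Phi)J+d_J(\operatorname{Tr}\Phi)\otimes\mathbb C=0$; - (D2) $d_h(\operatorname{Tr}\Phi)=0$. Moreover, if these conditions hold, then $S$ is metrizable by a Finsler function $F$ with $F^2=|R|$ on $T_0M$, and this $F$ has constant flag curvature $\kappa=\operatorname{sign}(R)$, the sign of $R$ being constant on $T_0M$. -/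

import Mathlib

open scoped Manifold ContDiff Topology

noncomputable section

namespace SprayGeometry

section Fields

variable (n : ℕ) (M : Type*) [TopologicalSpace M] [ChartedSpace (EuclideanSpace ℝ (Fin n)) M]
  [IsManifold (𝓡 n) ∞ M]

/-- The tangent bundle `TM`. -/
abbrev TM : Type _ := TangentBundle (𝓡 n) M

/-- The tangent space of `TM` at a point `p = (x, y)` of `TM`. -/
abbrev TTM (p : TM n M) : Type := TangentSpace (𝓡 n).tangent p

/-- (Not necessarily smooth) vector fields on `TM`. Only their values on `T₀M` will matter. -/
abbrev VField : Type _ := ∀ p : TM n M, TTM n M p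

/-- The tangent bundle with the zero section removed, `T₀M`, as an (open) subset of `TM`. -/
def slit : Set (TM n M) := {p | p.2 ≠ 0}

end Fields

variable {n : ℕ} {M : Type*} [TopologicalSpace M] [ChartedSpace (EuclideanSpace ℝ (Fin n)) M]
  [IsManifold (𝓡 n) ∞ M]

/-! ### Canonical structures on `TM` -/

/-- The differential of the projection `π : TM → M` at `p`. -/
def dproj (p : TM n M) : TTM n M p →L[ℝ] TangentSpace (𝓡 n) p.1 :=
  mfderiv (𝓡 n).tangent (𝓡 n) (fun q : TM n M => q.1) p

/-- The inclusion of the fibre `T_x M` (as a vector space, `ℝⁿ`) into `TM`. -/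
def fibreIncl (x : M) (w : EuclideanSpace ℝ (Fin n)) : TM n M := ⟨x, w⟩

/-- The vertical lift at `p = (x, y)`: the differential at `y` of the inclusion `T_x M → TM` of the
fibre; in induced coordinates `w ↦ wⁱ ∂/∂yⁱ`. -/
def vlift (p : TM n M) : TangentSpace (𝓡 n) p.1 →L[ℝ] TTM n M p :=
  mfderiv 𝓘(ℝ, EuclideanSpace ℝ (Fin n)) (𝓡 n).tangent (fibreIncl p.1) p.2

/-- The tangent structure `J = ∂/∂yⁱ ⊗ dxⁱ`, at a point. -/
def tangentStr (p : TM n M) : TTM n M p →L[ℝ] TTM n M p := (vlift p).comp (dproj p)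

/-- `J` as an operator on vector fields. -/
def J (X : VField n M) : VField n M := fun p => tangentStr p (X p)

/-- The Liouville vector field `ℂ = yⁱ ∂/∂yⁱ`. -/
def liouville : VField n M := fun p => vlift p p.2

/-! ### Calculus on `TM` -/

/-- The Lie bracket of vector fields on `TM`. -/
def bracket (X Y : VField n M) : VField n M := VectorField.mlieBracket (𝓡 n).tangent X Y

/-- The Lie derivative `L_S A` of a vector valued `1`-form `A` (seen as an operator on vector
fields): `(L_S A) X = [S, A X] - A [S, X]`. -/
def lieDer (S : VField n M) (A : VField n M → VField n M) (X : VField n M) : VField n M :=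
  bracket S (A X) - A (bracket S X)

/-- A smooth local extension of a tangent vector `w ∈ T_p TM` to a vector field near `p` (constant
components in the trivialization of `T(TM)` at `p`). A tensor field given as an operator on vector
fields is evaluated at a tangent vector by means of it; the choice of extension is immaterial. -/
def ext {p : TM n M} (w : TTM n M p) : VField n M :=
  FiberBundle.extend (EuclideanSpace ℝ (Fin n) × EuclideanSpace ℝ (Fin n)) w

/-- The value at a tangent vector of a vector valued `1`-form given as an operator on fields. -/
def evalAt (A : VField n M → VField n M) (p : TM n M) (w : TTM n M p) : TTM n M p := A (ext w) p

/-- The differential of a function at `p`. -/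
def diff (f : TM n M → ℝ) (p : TM n M) : TTM n M p →L[ℝ] ℝ :=
  mfderiv (𝓡 n).tangent 𝓘(ℝ, ℝ) f p

/-- The `1`-form `d_J f = df ∘ J`. -/
def dJ (f : TM n M → ℝ) (p : TM n M) : TTM n M p →L[ℝ] ℝ := (diff f p).comp (tangentStr p)

/-- The exterior derivative of a `1`-form on `TM`, evaluated at two tangent vectors:
`dθ (X, Y) = X (θ Y) - Y (θ X) - θ [X, Y]`. -/
def extDer (θ : ∀ p : TM n M, TTM n M p →L[ℝ] ℝ) (p : TM n M) (u w : TTM n M p) : ℝ :=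
  diff (fun q => θ q (ext w q)) p u - diff (fun q => θ q (ext u q)) p w
    - θ p (bracket (ext u) (ext w) p)

/-- The rank of a bilinear form `B` on a vector space: the dimension of the space of linear forms
`B (u, ·)`. -/
def formRank {V : Type*} (B : V → V → ℝ) : ℕ :=
  Module.finrank ℝ (Submodule.span ℝ (Set.range B))

/-! ### Sprays -/

/-- A spray: a smooth vector field `S` on `T₀M` with `J S = ℂ` and `[ℂ, S] = S`. -/
structure IsSpray (S : VField n M) : Prop where
  smooth : ContMDiffOn (𝓡 n).tangent (𝓡 n).tangent.tangent ∞
    (fun p => (⟨p, S p⟩ : TangentBundle (𝓡 n).tangent (TM n M))) (slit n M)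
  tangentStr_eq : ∀ p ∈ slit n M, tangentStr p (S p) = liouville p
  bracket_eq : ∀ p ∈ slit n M, bracket liouville S p = S p

/-- The horizontal projector `h = (Id - L_S J) / 2`. -/
def hor (S : VField n M) (X : VField n M) : VField n M := (1 / 2 : ℝ) • (X - lieDer S J X)

/-- The vertical projector `v = (Id + L_S J) / 2`. -/
def ver (S : VField n M) (X : VField n M) : VField n M := (1 / 2 : ℝ) • (X + lieDer S J X)

/-- The Jacobi endomorphism `Φ = v ∘ L_S h`. -/
def jacobi (S : VField n M) (X : VField n M) : VField n M := ver S (lieDer S (hor S) X)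

open Classical in
/-- The trace `Rⁱᵢ` of a semi-basic, vertical valued `1`-form `Rⁱⱼ ∂/∂yⁱ ⊗ dxʲ` at `p = (x, y)`, that
is, the trace of the linear map `φ` of `T_x M` such that the form is `w ↦ (φ (dπ w))` lifted
vertically; such a map is unique. -/
def semibasicTrace (p : TM n M) (A : TTM n M p → TTM n M p) : ℝ :=
  if hφ : ∃ φ : TangentSpace (𝓡 n) p.1 →ₗ[ℝ] TangentSpace (𝓡 n) p.1,
      ∀ w, A w = vlift p (φ (dproj p w)) then
    LinearMap.trace ℝ (TangentSpace (𝓡 n) p.1) hφ.choose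
  else 0

/-- The Ricci curvature `Ric = Tr Φ`. -/
def ricci (S : VField n M) (p : TM n M) : ℝ := semibasicTrace p (evalAt (jacobi S) p)

/-- The Ricci scalar `R`, given by `Ric = (n - 1) R`. -/
def ricciScalar (S : VField n M) (p : TM n M) : ℝ := ricci S p / ((n : ℝ) - 1)

/-! ### Finsler functions -/

/-- A Finsler function: continuous on `TM`, smooth and positive on `T₀M`, positively homogeneous of
degree one, with metric tensor (the Hessian of `F² / 2` along the fibres) of rank `n` on `T₀M`. -/
structure IsFinsler (F : TM n M → ℝ) : Prop where
  continuous : Continuous F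
  smooth : ContMDiffOn (𝓡 n).tangent 𝓘(ℝ, ℝ) ∞ F (slit n M)
  pos : ∀ p ∈ slit n M, 0 < F p
  homogeneous : ∀ (x : M) (y : TangentSpace (𝓡 n) x) (t : ℝ), 0 ≤ t →
    F ⟨x, t • y⟩ = t * F ⟨x, y⟩
  rank_metric : ∀ p ∈ slit n M, Module.finrank ℝ (LinearMap.range
    (fderiv ℝ (fderiv ℝ (fun y : EuclideanSpace ℝ (Fin n) =>
      F (fibreIncl p.1 y) ^ 2 / 2)) p.2).toLinearMap) = n

/-- `F` metrizes `S`, i.e. `S` is the geodesic spray of `F`: `i_S d d_J F² = - d F²` on `T₀M`. -/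
def Metrizes (F : TM n M → ℝ) (S : VField n M) : Prop :=
  ∀ p ∈ slit n M, ∀ w : TTM n M p,
    extDer (dJ (fun q => F q ^ 2)) p (S p) w = - diff (fun q => F q ^ 2) p w

/-- The Finsler function `F` with geodesic spray `S` has constant flag curvature `κ`:
`Φ = κ (F² J - F d_J F ⊗ ℂ)` on `T₀M`. -/
def HasConstantFlagCurvature (F : TM n M → ℝ) (S : VField n M) (κ : ℝ) : Prop :=
  ∀ p ∈ slit n M, ∀ w : TTM n M p,
    evalAt (jacobi S) p w = κ • (F p ^ 2 • tangentStr p w - (F p * dJ F p w) • liouville p)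

/-! ### The three conditions -/

/-- `rank d d_J (Tr Φ) = 2n` on `T₀M`. -/
def CondA (S : VField n M) : Prop :=
  ∀ p ∈ slit n M, formRank (extDer (dJ (ricci S)) p) = 2 * n

/-- `2 (n - 1) Φ - 2 (Tr Φ) J + d_J (Tr Φ) ⊗ ℂ = 0` on `T₀M`. -/
def CondD1 (S : VField n M) : Prop :=
  ∀ p ∈ slit n M, ∀ w : TTM n M p,
    (2 * ((n : ℝ) - 1)) • evalAt (jacobi S) p w - (2 * ricci S p) • tangentStr p w
      + dJ (ricci S) p w • liouville p = 0

/-- `d_h (Tr Φ) = 0` on `T₀M`. -/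
def CondD2 (S : VField n M) : Prop :=
  ∀ p ∈ slit n M, ∀ w : TTM n M p, diff (ricci S) p (evalAt (hor S) p w) = 0

end SprayGeometry

end

/-! Write the flag curvature equation as Φ = κ(F²J − ½ d_J F² ⊗ ℂ) and take traces: J contributes n,
and d_J F² ⊗ ℂ contributes ℂ(F²) = 2F² by Euler's relation. Hence Ric = (n−1)κF², so F² can only be
a constant multiple of Ric.

Once Ric = cF² with c ≠ 0, each condition becomes one requirement on F. Condition (A) is
nondegeneracy of the metric (`condA_iff`), because dd_J L has full rank exactly when the fibre
Hessian of L is nondegenerate (`twoForm_nondegenerate_iff`). Condition (D1) is the flag curvature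
equation (`condD1_iff`). Condition (D2) is d_h F² = 0 (`condD2_iff`), which is equivalent to i_S
dd_J F² = −dF² (`metrizes_iff`).

For this last equivalence put L = F². Differentiating ℂ(L) = 2L and S(L) = 0 in induced coordinates
gives i_S dd_J L + dL = −2 d_h L. The auxiliary relation S(L) = 0 follows from either side: S is
horizontal because [ℂ,S] = S, and dd_J L is alternating.

For the converse take F = √|R|. The trace of (D1) is ℂ(Ric) = 2 Ric (`CondD1.euler`); integrated
along rays it makes Ric 2-homogeneous (`homogeneous_of_euler`), whence F is 1-homogeneous and
continuous at the zero section (`continuous_of_homogeneous`). The sign of R is constant by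
connectedness (`pos_or_neg_of_ne_zero`).

All computations take place in induced charts (x, y), where S = (y, −N y) and Φ is given by the
matrix `curv` (`rep_jacobi`). -/

noncomputable section

/-! ### Vector fields and functions read in a chart -/

namespace ChartRep

open VectorField Bundle

variable {E : Type*} [NormedAddCommGroup E] [NormedSpace ℝ E]
  {H : Type*} [TopologicalSpace H] {I : ModelWithCorners ℝ E H}
  {N : Type*} [TopologicalSpace N] [ChartedSpace H N]

/-- The differential at `q` of the chart at `x₀`. -/
def dchart (I : ModelWithCorners ℝ E H) (x₀ q : N) : TangentSpace I q →L[ℝ] E :=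
  mfderiv I 𝓘(ℝ, E) (extChartAt I x₀) q

/-- The components, in the chart at `x₀`, of a vector field. -/
def field (I : ModelWithCorners ℝ E H) (x₀ : N) (X : ∀ x : N, TangentSpace I x) (z : E) : E :=
  dchart I x₀ ((extChartAt I x₀).symm z) (X ((extChartAt I x₀).symm z))

/-- The expression of a function in the chart at `x₀`. -/
def func (I : ModelWithCorners ℝ E H) (x₀ : N) (f : N → ℝ) (z : E) : ℝ :=
  f ((extChartAt I x₀).symm z)

theorem field_apply {x₀ q : N} (hq : q ∈ (extChartAt I x₀).source)
    (X : ∀ x : N, TangentSpace I x) :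
    field I x₀ X (extChartAt I x₀ q) = dchart I x₀ q (X q) := by
  unfold field
  rw [(extChartAt I x₀).left_inv hq]

theorem func_apply {x₀ q : N} (hq : q ∈ (extChartAt I x₀).source) (f : N → ℝ) :
    func I x₀ f (extChartAt I x₀ q) = f q := by
  unfold func
  rw [(extChartAt I x₀).left_inv hq]

theorem dchart_apply [IsManifold I 1 N] {x₀ q : N} (hq : q ∈ (chartAt H x₀).source)
    (w : TangentSpace I q) :
    dchart I x₀ q w = ((trivializationAt E (TangentSpace I) x₀) ⟨q, w⟩).2 := by
  have h := Trivialization.coe_linearMapAt_of_mem (R := ℝ)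
    (trivializationAt E (TangentSpace I) x₀) (b := q) (by simpa using hq)
  refine Eq.trans ?_ (congrFun h w)
  unfold dchart
  rw [← TangentBundle.continuousLinearMapAt_trivializationAt hq]
  rfl

theorem mfderiv_eq_func [IsManifold I ∞ N] {x₀ q : N} (hq : q ∈ (extChartAt I x₀).source) {f : N → ℝ}
    (hf : DifferentiableAt ℝ (func I x₀ f) (extChartAt I x₀ q)) (w : TangentSpace I q) :
    mfderiv I 𝓘(ℝ, ℝ) f q w =
      fderiv ℝ (func I x₀ f) (extChartAt I x₀ q) (dchart I x₀ q w) := by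
  have : IsManifold I 1 N := .of_le (n := ∞) (by simp)
  have h2 : mfderiv I 𝓘(ℝ, ℝ) f q = mfderiv I 𝓘(ℝ, ℝ) (func I x₀ f ∘ extChartAt I x₀) q := by
    refine Filter.EventuallyEq.mfderiv_eq ?_
    filter_upwards [(isOpen_extChartAt_source x₀).mem_nhds hq] with x hx
    exact (func_apply hx f).symm
  rw [h2, mfderiv_comp (I' := 𝓘(ℝ, E)) _ hf.mdifferentiableAt
        (mdifferentiableAt_extChartAt (by simpa using hq)), mfderiv_eq_fderiv]
  rfl

variable [I.Boundaryless]

theorem target_mem_nhds {x₀ : N} {z : E} (hz : z ∈ (extChartAt I x₀).target) :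
    (extChartAt I x₀).target ∈ 𝓝 z :=
  (isOpen_extChartAt_target x₀).mem_nhds hz

variable [IsManifold I ∞ N]

theorem contMDiffAt_symm {x₀ : N} {z : E} (hz : z ∈ (extChartAt I x₀).target) :
    ContMDiffAt 𝓘(ℝ, E) I ∞ (extChartAt I x₀).symm z :=
  (contMDiffOn_extChartAt_symm x₀).contMDiffAt (target_mem_nhds hz)

theorem contMDiffAt_iff_func {x₀ q : N} (hq : q ∈ (extChartAt I x₀).source) {f : N → ℝ}
    {k : WithTop ℕ∞} (hk : k ≤ ∞) :
    ContMDiffAt I 𝓘(ℝ, ℝ) k f q ↔ ContDiffAt ℝ k (func I x₀ f) (extChartAt I x₀ q) := by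
  have : IsManifold I k N := .of_le hk
  rw [contMDiffAt_iff_source_of_mem_source (x := x₀) (by simpa using hq), I.range_eq_univ,
    contMDiffWithinAt_univ, contMDiffAt_iff_contDiffAt]
  rfl

theorem contMDiffAt_iff_field {x₀ q : N} (hq : q ∈ (extChartAt I x₀).source)
    {X : ∀ x : N, TangentSpace I x} :
    ContMDiffAt I I.tangent ∞ (fun x => (⟨x, X x⟩ : TangentBundle I N)) q ↔
      ContDiffAt ℝ ∞ (field I x₀ X) (extChartAt I x₀ q) := by
  have : IsManifold I 1 N := .of_le (n := ∞) (by simp)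
  rw [extChartAt_source] at hq
  have h := (trivializationAt E (TangentSpace I) x₀).contMDiffAt_section_iff (IB := I) (n := ∞)
    (s := X) (x₀ := q) (by simpa using hq)
  refine h.trans ?_
  have h2 : (fun x => ((trivializationAt E (TangentSpace I) x₀) ⟨x, X x⟩).2) =ᶠ[𝓝 q]
      fun x => dchart I x₀ x (X x) := by
    filter_upwards [(chartAt H x₀).open_source.mem_nhds hq] with x hx
    exact (dchart_apply hx (X x)).symm
  rw [h2.contMDiffAt_iff, contMDiffAt_iff_source_of_mem_source (x := x₀) hq, I.range_eq_univ,
    contMDiffWithinAt_univ, contMDiffAt_iff_contDiffAt]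
  rfl

/-- The differentials of the chart and of its inverse are mutually inverse, so pushing forward by
one is pulling back by the other. This makes naturality of the bracket under pullback available. -/
theorem field_eq_mpullback {x₀ : N} {z : E} (hz : z ∈ (extChartAt I x₀).target)
    (X : ∀ x : N, TangentSpace I x) :
    field I x₀ X z = mpullback 𝓘(ℝ, E) I (extChartAt I x₀).symm X z := by
  have : IsManifold I 1 N := .of_le (n := ∞) (by simp)
  have h1 := mfderiv_extChartAt_comp_mfderivWithin_extChartAt_symm (I := I) hz
  have h2 := isInvertible_mfderivWithin_extChartAt_symm (I := I) hz
  rw [I.range_eq_univ, mfderivWithin_univ] at h1 h2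
  rw [mpullback_apply, field]
  obtain ⟨e, he⟩ := h2
  rw [← he] at h1 ⊢
  rw [ContinuousLinearMap.inverse_equiv]
  have := congrArg (fun L => L (e.symm (X ((extChartAt I x₀).symm z)))) h1
  simp only [ContinuousLinearMap.comp_apply] at this
  erw [e.apply_symm_apply] at this
  exact this

variable [CompleteSpace E]

theorem field_mlieBracket {x₀ : N} {z : E} (hz : z ∈ (extChartAt I x₀).target)
    {X Y : ∀ x : N, TangentSpace I x} (hX : ContDiffAt ℝ ∞ (field I x₀ X) z)
    (hY : ContDiffAt ℝ ∞ (field I x₀ Y) z) :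
    field I x₀ (mlieBracket I X Y) z = lieBracket ℝ (field I x₀ X) (field I x₀ Y) z := by
  have : IsManifold I (minSmoothness ℝ 3) N := .of_le (n := ∞) (by simpa using ENat.LEInfty.out)
  have : IsManifold I 1 N := .of_le (n := ∞) (by simp)
  have hs := (extChartAt I x₀).map_target hz
  have hr := (extChartAt I x₀).right_inv hz
  rw [← hr, ← contMDiffAt_iff_field hs] at hX hY
  rw [field_eq_mpullback hz, mpullback_mlieBracket (n := ∞) (hX.mdifferentiableAt (by simp))
    (hY.mdifferentiableAt (by simp)) (contMDiffAt_symm hz) (by simpa using ENat.LEInfty.out),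
    ← mlieBracketWithin_univ, mlieBracketWithin_eq_lieBracketWithin]
  refine (congrFun (lieBracketWithin_univ (𝕜 := ℝ)) z).trans ?_
  refine Filter.EventuallyEq.lieBracket_vectorField_eq ?_ ?_ <;>
  · filter_upwards [target_mem_nhds hz] with z' hz'
    exact (field_eq_mpullback hz' _).symm

end ChartRep

/-! ### Sprays on an open subset of a vector space -/

namespace SprayCoord

open VectorField

/-! ### Maps smooth near a point: a class stable under derivatives and brackets -/

section SmoothNear

variable {A B C : Type*} [NormedAddCommGroup A] [NormedSpace ℝ A] [NormedAddCommGroup B]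
  [NormedSpace ℝ B] [NormedAddCommGroup C] [NormedSpace ℝ C]

/-- `f` is smooth in a neighbourhood of `z`. -/
def SmoothNear (f : A → B) (z : A) : Prop := ∀ᶠ z' in 𝓝 z, ContDiffAt ℝ ∞ f z'

variable {f : A → B} {z : A}

theorem SmoothNear.contDiffAt (h : SmoothNear f z) : ContDiffAt ℝ ∞ f z := h.self_of_nhds

theorem SmoothNear.differentiableAt (h : SmoothNear f z) : DifferentiableAt ℝ f z :=
  h.contDiffAt.differentiableAt (by simp)

theorem SmoothNear.eventually (h : SmoothNear f z) : ∀ᶠ z' in 𝓝 z, SmoothNear f z' :=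
  eventually_eventually_nhds.2 h

theorem SmoothNear.congr {g : A → B} (h : SmoothNear f z) (hg : g =ᶠ[𝓝 z] f) :
    SmoothNear g z := by
  filter_upwards [h, hg.eventuallyEq_nhds] with z' h1 h2
  exact h1.congr_of_eventuallyEq h2

theorem SmoothNear.fderiv (h : SmoothNear f z) : SmoothNear (fderiv ℝ f) z := by
  filter_upwards [h] with z' h1
  exact h1.fderiv_right (by simp)

theorem SmoothNear.lieBracket {X Y : A → A} (hX : SmoothNear X z) (hY : SmoothNear Y z) :
    SmoothNear (lieBracket ℝ X Y) z := by
  filter_upwards [hX, hY] with z' h1 h2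
  exact h1.lieBracket_vectorField h2 (by simp)

theorem SmoothNear.comp_contDiff {g : B → C} (hg : ContDiff ℝ ∞ g) (h : SmoothNear f z) :
    SmoothNear (fun x => g (f x)) z := by
  filter_upwards [h] with z' h1
  exact hg.contDiffAt.comp z' h1

theorem SmoothNear.prodMk {g : A → C} (h : SmoothNear f z) (hg : SmoothNear g z) :
    SmoothNear (fun x => (f x, g x)) z := by
  filter_upwards [h, hg] with z' h1 h2
  exact h1.prodMk h2

theorem SmoothNear.clm_apply {L : A → B →L[ℝ] C} (hL : SmoothNear L z) (h : SmoothNear f z) :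
    SmoothNear (fun x => L x (f x)) z := by
  filter_upwards [hL, h] with z' h1 h2
  exact h1.clm_apply h2

theorem SmoothNear.sub {g : A → B} (h : SmoothNear f z) (hg : SmoothNear g z) :
    SmoothNear (fun x => f x - g x) z := by
  filter_upwards [h, hg] with z' h1 h2
  exact h1.sub h2

theorem SmoothNear.neg (h : SmoothNear f z) : SmoothNear (fun x => -f x) z := by
  filter_upwards [h] with z' h1
  exact h1.neg

end SmoothNear

variable {V : Type*} [NormedAddCommGroup V] [NormedSpace ℝ V]

/-- The coefficients `Nⁱⱼ = ∂Gⁱ/∂yʲ` of the nonlinear connection of `S = yⁱ∂/∂xⁱ - 2Gⁱ∂/∂yⁱ`. -/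
def conn (S : V × V → V × V) (z : V × V) : V →L[ℝ] V :=
  (-(1 / 2 : ℝ)) • (ContinuousLinearMap.snd ℝ V V ∘L fderiv ℝ S z ∘L ContinuousLinearMap.inr ℝ V V)

/-- The derivative `-2 ∂Gⁱ/∂xʲ`. -/
def baseDeriv (S : V × V → V × V) (z : V × V) : V →L[ℝ] V :=
  ContinuousLinearMap.snd ℝ V V ∘L fderiv ℝ S z ∘L ContinuousLinearMap.inl ℝ V V

/-- The components `Rⁱⱼ = 2 ∂Gⁱ/∂xʲ - S(Nⁱⱼ) - Nⁱₖ Nᵏⱼ` of the Jacobi endomorphism. -/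
def curv (S : V × V → V × V) (z : V × V) : V →L[ℝ] V :=
  -(fderiv ℝ (conn S) z (S z)) - baseDeriv S z - conn S z ∘L conn S z

variable {S X : V × V → V × V} {z : V × V}

theorem smoothNear_conn (hS : SmoothNear S z) : SmoothNear (conn S) z := by
  filter_upwards [hS.fderiv] with z' h
  have h1 : ContDiffAt ℝ ∞ (fun y => ContinuousLinearMap.snd ℝ V V ∘L fderiv ℝ S y ∘L
      ContinuousLinearMap.inr ℝ V V) z' :=
    contDiffAt_const.clm_comp (h.clm_comp contDiffAt_const)
  exact h1.const_smul _

theorem smoothNear_curv (hS : SmoothNear S z) : SmoothNear (curv S) z := by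
  filter_upwards [hS.fderiv, hS, smoothNear_conn hS, (smoothNear_conn hS).fderiv] with z' h h0 h1 h2
  refine ((h2.clm_apply h0).neg.sub ?_).sub (h1.clm_comp h1)
  exact contDiffAt_const.clm_comp (h.clm_comp contDiffAt_const)

/-- The field `S` is a second order equation near `z`: `J S = ℂ`. -/
def IsSecondOrder (S : V × V → V × V) (z : V × V) : Prop := ∀ᶠ z' in 𝓝 z, (S z').1 = z'.2

/-- The first component of S agrees with the projection to y near z, so it has the same derivative;
the y-derivative of the second component is −2N by definition of `conn`. -/
theorem fderiv_secondOrder (hS : DifferentiableAt ℝ S z) (h2 : IsSecondOrder S z) (u : V × V) :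
    fderiv ℝ S z u = (u.2, baseDeriv S z u.1 - (2 : ℝ) • conn S z u.2) := by
  have h1 : (fderiv ℝ S z u).1 = u.2 := by
    have e1 : HasFDerivAt (fun z => (S z).1) (ContinuousLinearMap.fst ℝ V V ∘L fderiv ℝ S z) z :=
      hS.hasFDerivAt.fst
    have e2 : HasFDerivAt (fun z => (S z).1) (ContinuousLinearMap.snd ℝ V V) z :=
      (ContinuousLinearMap.snd ℝ V V).hasFDerivAt.congr_of_eventuallyEq h2
    exact congrArg (fun L => L u) (e1.unique e2)
  refine Prod.ext h1 ?_
  have : u = (u.1, 0) + (0, u.2) := by simp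
  conv_lhs => rw [this, map_add]
  simp [conn, baseDeriv, smul_smul]

theorem fderiv_vertical (hX : DifferentiableAt ℝ X z) (u : V × V) :
    fderiv ℝ (fun z => ((0 : V), (X z).1)) z u = (0, (fderiv ℝ X z u).1) := by
  have e := (hasFDerivAt_const (0 : V) z).prodMk (hX.hasFDerivAt.fst)
  rw [e.fderiv]; rfl

/-- This is L_S J in coordinates, (a, b) ↦ (−a, 2Na + b): it is −1 on vectors (a, −Na) and +1 on
vertical ones, which makes h and v projectors. -/
theorem lieBracket_vertical_sub (hS : DifferentiableAt ℝ S z) (h2 : IsSecondOrder S z)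
    (hX : DifferentiableAt ℝ X z) :
    lieBracket ℝ S (fun z => ((0 : V), (X z).1)) z - (0, (lieBracket ℝ S X z).1) =
      (-(X z).1, (2 : ℝ) • conn S z (X z).1 + (X z).2) := by
  simp only [lieBracket, fderiv_vertical hX, fderiv_secondOrder hS h2]
  ext <;> simp

/-- The horizontal part of a field. -/
def horPart (S X : V × V → V × V) (z : V × V) : V × V := ((X z).1, -conn S z (X z).1)

theorem smoothNear_horPart (hS : SmoothNear S z) (hX : SmoothNear X z) :
    SmoothNear (horPart S X) z := by
  have h1 : SmoothNear (fun z => (X z).1) z := hX.comp_contDiff contDiff_fst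
  exact h1.prodMk ((smoothNear_conn hS).clm_apply h1).neg

theorem fderiv_horPart (hN : DifferentiableAt ℝ (conn S) z) (hX : DifferentiableAt ℝ X z)
    (u : V × V) :
    fderiv ℝ (horPart S X) z u = ((fderiv ℝ X z u).1,
      -(fderiv ℝ (conn S) z u (X z).1 + conn S z (fderiv ℝ X z u).1)) := by
  have e := hX.hasFDerivAt.fst.prodMk (hN.hasFDerivAt.clm_apply hX.hasFDerivAt.fst).neg
  have e' : HasFDerivAt (horPart S X) _ z := e
  rw [e'.fderiv]
  simp [add_comm]

/-- The derivatives of X cancel, so v[S, hX] depends only on the value of the first component of X: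
this is the tensoriality of Φ. -/
theorem ver_lieBracket_horPart (hS : SmoothNear S z) (h2 : IsSecondOrder S z)
    (hX : DifferentiableAt ℝ X z) :
    (lieBracket ℝ S (horPart S X) z).2 + conn S z (lieBracket ℝ S (horPart S X) z).1 =
      curv S z (X z).1 := by
  simp only [lieBracket, fderiv_horPart (smoothNear_conn hS).differentiableAt hX,
    fderiv_secondOrder hS.differentiableAt h2, curv]
  simp [horPart, two_smul]
  abel

/-! ### Lagrangians -/

variable {L : V × V → ℝ}

/-- The two-form `d d_J L` in coordinates. -/
def twoForm (L : V × V → ℝ) (z u w : V × V) : ℝ :=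
  fderiv ℝ (fderiv ℝ L) z u (0, w.1) - fderiv ℝ (fderiv ℝ L) z w (0, u.1)

theorem fderiv_dJ (hL : SmoothNear L z) (hX : DifferentiableAt ℝ X z) (u : V × V) :
    fderiv ℝ (fun z => fderiv ℝ L z (0, (X z).1)) z u =
      fderiv ℝ (fderiv ℝ L) z u (0, (X z).1) + fderiv ℝ L z (0, (fderiv ℝ X z u).1) := by
  have e := hL.fderiv.differentiableAt.hasFDerivAt.clm_apply
    ((hasFDerivAt_const (0 : V) z).prodMk hX.hasFDerivAt.fst)
  rw [e.fderiv]
  simp [add_comm]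

/-- The bracket term cancels exactly the terms in which the fields X and Y are differentiated. -/
theorem exteriorDeriv_dJ {Y : V × V → V × V} (hL : SmoothNear L z) (hX : DifferentiableAt ℝ X z)
    (hY : DifferentiableAt ℝ Y z) :
    fderiv ℝ (fun z => fderiv ℝ L z (0, (Y z).1)) z (X z) -
      fderiv ℝ (fun z => fderiv ℝ L z (0, (X z).1)) z (Y z) -
      fderiv ℝ L z (0, (lieBracket ℝ X Y z).1) = twoForm L z (X z) (Y z) := by
  rw [fderiv_dJ hL hX, fderiv_dJ hL hY, lieBracket, twoForm]
  have : ((0 : V), (fderiv ℝ Y z (X z) - fderiv ℝ X z (Y z)).1) =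
      (0, (fderiv ℝ Y z (X z)).1) - (0, (fderiv ℝ X z (Y z)).1) := by simp
  rw [this, map_sub]
  ring

theorem fderiv_fderiv_comm (hL : SmoothNear L z) (u w : V × V) :
    fderiv ℝ (fderiv ℝ L) z u w = fderiv ℝ (fderiv ℝ L) z w u :=
  (hL.contDiffAt.isSymmSndFDerivAt (by simpa using ENat.LEInfty.out)).eq u w

/-- Derivative of the Euler relation for a function `2`-homogeneous in the fibre variable. -/
theorem fderiv_euler (hL : SmoothNear L z)
    (hE : ∀ᶠ z' in 𝓝 z, fderiv ℝ L z' (0, z'.2) = 2 * L z') (w : V × V) :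
    fderiv ℝ (fderiv ℝ L) z w (0, z.2) + fderiv ℝ L z (0, w.2) = 2 * fderiv ℝ L z w := by
  have e1 := hL.fderiv.differentiableAt.hasFDerivAt.clm_apply
    ((hasFDerivAt_const (0 : V) z).prodMk (ContinuousLinearMap.snd ℝ V V).hasFDerivAt)
  have e2 := (hL.differentiableAt.hasFDerivAt.const_mul (2 : ℝ)).congr_of_eventuallyEq hE
  have := congrArg (fun T => T w) (e1.unique e2)
  simpa [add_comm] using this

/-- Derivative along the fibres of the relation `S(L) = 0`. -/
theorem fderiv_spray_apply (hS : SmoothNear S z) (h2 : IsSecondOrder S z) (hL : SmoothNear L z)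
    (h0 : ∀ᶠ z' in 𝓝 z, fderiv ℝ L z' (S z') = 0) (a : V) :
    fderiv ℝ (fderiv ℝ L) z (S z) (0, a) + fderiv ℝ L z (a, 0)
      - 2 * fderiv ℝ L z (0, conn S z a) = 0 := by
  have e1 := hL.fderiv.differentiableAt.hasFDerivAt.clm_apply hS.differentiableAt.hasFDerivAt
  have e2 : HasFDerivAt (fun y => fderiv ℝ L y (S y)) (0 : V × V →L[ℝ] ℝ) z :=
    (hasFDerivAt_const (0 : ℝ) z).congr_of_eventuallyEq h0
  have := congrArg (fun T => T (0, a)) (e1.unique e2)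
  simp [fderiv_secondOrder hS.differentiableAt h2] at this
  rw [fderiv_fderiv_comm hL (S z)]
  have e3 : ((a, -((2 : ℝ) • conn S z a)) : V × V) = (a, 0) - (2 : ℝ) • (0, conn S z a) := by simp
  rw [e3, map_sub, map_smul] at this
  simp only [smul_eq_mul] at this
  linarith

theorem fderiv_apply_eq_add (u : V × V) :
    fderiv ℝ L z u = fderiv ℝ L z (u.1, 0) + fderiv ℝ L z (0, u.2) := by
  rw [← map_add]; simp

/-- A `2`-homogeneous function that is constant along the horizontal fields solves the equation
`i_S d d_J L = - d L`. -/
theorem twoForm_spray_of_horizontal (hS : SmoothNear S z) (h2 : IsSecondOrder S z)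
    (hS2 : ∀ᶠ z' in 𝓝 z, S z' = (z'.2, -conn S z' z'.2)) (hL : SmoothNear L z)
    (hE : ∀ᶠ z' in 𝓝 z, fderiv ℝ L z' (0, z'.2) = 2 * L z')
    (hH : ∀ᶠ z' in 𝓝 z, ∀ a, fderiv ℝ L z' (a, -conn S z' a) = 0) (w : V × V) :
    twoForm L z (S z) w = -fderiv ℝ L z w := by
  -- S is itself horizontal, so L is constant along it.
  have h0 : ∀ᶠ z' in 𝓝 z, fderiv ℝ L z' (S z') = 0 := by
    filter_upwards [hS2, hH] with z' h1 h3
    rw [h1]; exact h3 _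
  -- Substituting `e1` and `e2` into the two terms of `twoForm` gives i_S dd_J L + dL = −2 d_h L,
  -- which vanishes by `e3`.
  have e1 := fderiv_spray_apply hS h2 hL h0 w.1
  have e2 := fderiv_euler hL hE w
  have e3 := hH.self_of_nhds w.1
  rw [fderiv_apply_eq_add] at e3
  have e4 : fderiv ℝ L z (0, -conn S z w.1) = -fderiv ℝ L z (0, conn S z w.1) := by
    rw [← map_neg (fderiv ℝ L z), Prod.neg_mk, neg_zero]
  have e5 := fderiv_apply_eq_add (L := L) (z := z) w
  rw [twoForm, h2.self_of_nhds]
  simp only at e3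
  linarith

/-- A `2`-homogeneous solution of `i_S d d_J L = - d L` is constant along the horizontal fields. -/
theorem horizontal_of_twoForm_spray (hS : SmoothNear S z) (h2 : IsSecondOrder S z)
    (hL : SmoothNear L z) (hE : ∀ᶠ z' in 𝓝 z, fderiv ℝ L z' (0, z'.2) = 2 * L z')
    (hM : ∀ᶠ z' in 𝓝 z, ∀ w, twoForm L z' (S z') w = -fderiv ℝ L z' w) (a : V) :
    fderiv ℝ L z (a, -conn S z a) = 0 := by
  have h0 : ∀ᶠ z' in 𝓝 z, fderiv ℝ L z' (S z') = 0 := by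
    filter_upwards [hM] with z' h1
    -- An alternating form vanishes on the pair (S, S), so the equation evaluated on S reads S(L) =
    -- 0.
    have := h1 (S z')
    rw [twoForm, sub_self] at this
    linarith
  have e1 := fderiv_spray_apply hS h2 hL h0 a
  have e2 := fderiv_euler hL hE (a, 0)
  have e3 := hM.self_of_nhds (a, 0)
  rw [twoForm, h2.self_of_nhds] at e3
  have e4 : fderiv ℝ L z (0, -conn S z a) = -fderiv ℝ L z (0, conn S z a) := by
    rw [← map_neg (fderiv ℝ L z), Prod.neg_mk, neg_zero]
  rw [fderiv_apply_eq_add]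
  simp only at e2 e3 ⊢
  have e5 : fderiv ℝ L z ((0, 0) : V × V) = 0 := map_zero _
  linarith

/-- The form `d d_J L` is nondegenerate if and only if the fibre Hessian of `L` is. -/
theorem twoForm_nondegenerate_iff (hL : SmoothNear L z) :
    (∀ u, (∀ w, twoForm L z u w = 0) → u = 0) ↔
      ∀ b : V, (∀ c : V, fderiv ℝ (fderiv ℝ L) z (0, b) (0, c) = 0) → b = 0 := by
  constructor
  · intro h b hb
    have := h (0, b) fun w => by
      have e : fderiv ℝ (fderiv ℝ L) z w (0, 0) = 0 := map_zero _
      rw [twoForm, hb, e, sub_zero]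
    exact congrArg Prod.snd this
  · intro h u hu
    -- The form vanishes on pairs of vertical vectors, and pairs vertical with base directions
    -- through the fibre Hessian. Testing against (0, c) therefore isolates `u.1`; once it is zero,
    -- testing against (c, 0) isolates `u.2`.
    have h1 : u.1 = 0 := by
      refine h _ fun c => ?_
      have := hu (0, c)
      rw [twoForm] at this
      have e : fderiv ℝ (fderiv ℝ L) z u (0, 0) = 0 := map_zero _
      rw [fderiv_fderiv_comm hL]
      simp only at this
      linarith
    have h3 : u.2 = 0 := by
      refine h _ fun c => ?_
      have := hu (c, 0)
      have e : fderiv ℝ (fderiv ℝ L) z (c, 0) (0, 0) = 0 := map_zero _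
      rw [twoForm, h1, e, sub_zero] at this
      rw [← this, ← h1]
    exact Prod.ext h1 h3

end SprayCoord

namespace SprayGeometry

open ChartRep SprayCoord

variable {n : ℕ} {M : Type*} [TopologicalSpace M] [ChartedSpace (EuclideanSpace ℝ (Fin n)) M]
  [IsManifold (𝓡 n) ∞ M]

/-! ### Induced coordinates on `TM` -/

/-- The chart of `TM` at `p₀`, given by induced coordinates `(x, y)`. -/
abbrev chartTM (p₀ : TM n M) :
    PartialEquiv (TM n M) (EuclideanSpace ℝ (Fin n) × EuclideanSpace ℝ (Fin n)) :=
  extChartAt (𝓡 n).tangent p₀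

/-- The differential of the chart of `TM`. -/
abbrev dTot (p₀ q : TM n M) :
    TTM n M q →L[ℝ] EuclideanSpace ℝ (Fin n) × EuclideanSpace ℝ (Fin n) :=
  dchart (𝓡 n).tangent p₀ q

/-- The differential of the chart of `M`. -/
abbrev dBase (p₀ q : TM n M) : TangentSpace (𝓡 n) q.1 →L[ℝ] EuclideanSpace ℝ (Fin n) :=
  dchart (𝓡 n) p₀.1 q.1

/-- Components of a vector field in the chart of `TM` at `p₀`. -/
abbrev rep (p₀ : TM n M) (X : VField n M) :
    EuclideanSpace ℝ (Fin n) × EuclideanSpace ℝ (Fin n) →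
      EuclideanSpace ℝ (Fin n) × EuclideanSpace ℝ (Fin n) :=
  field (𝓡 n).tangent p₀ X

/-- Expression of a function in the chart of `TM` at `p₀`. -/
abbrev repf (p₀ : TM n M) (f : TM n M → ℝ) :
    EuclideanSpace ℝ (Fin n) × EuclideanSpace ℝ (Fin n) → ℝ :=
  func (𝓡 n).tangent p₀ f

theorem isManifold_one : IsManifold (𝓡 n) 1 M := .of_le (n := ∞) (by simp)

theorem isManifold_one_TM : IsManifold (𝓡 n).tangent 1 (TM n M) := .of_le (n := ∞) (by simp)

variable {p₀ q : TM n M}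

theorem mem_chartTM_source :
    q ∈ (chartTM p₀).source ↔ q.1 ∈ (chartAt (EuclideanSpace ℝ (Fin n)) p₀.1).source := by
  rw [extChartAt_source, TangentBundle.mem_chart_source_iff]

theorem chartTM_apply (hq : q ∈ (chartTM p₀).source) :
    chartTM p₀ q = (extChartAt (𝓡 n) p₀.1 q.1, dBase p₀ q q.2) := by
  have := isManifold_one (n := n) (M := M)
  have h := FiberBundle.extChartAt (F := EuclideanSpace ℝ (Fin n)) (E := TangentSpace (𝓡 n))
    (IB := 𝓡 n) p₀
  have h2 := dchart_apply (I := 𝓡 n) (mem_chartTM_source.1 hq) q.2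
  refine (congrFun (congrArg PartialEquiv.toFun h) q).trans ?_
  exact Prod.ext rfl h2.symm

theorem isInvertible_dTot (hq : q ∈ (chartTM p₀).source) : (dTot p₀ q).IsInvertible := by
  have := isManifold_one_TM (n := n) (M := M)
  exact isInvertible_mfderiv_extChartAt hq

theorem isInvertible_dBase (hq : q ∈ (chartTM p₀).source) : (dBase p₀ q).IsInvertible := by
  have := isManifold_one (n := n) (M := M)
  exact isInvertible_mfderiv_extChartAt (by simpa using mem_chartTM_source.1 hq)

theorem dTot_injective (hq : q ∈ (chartTM p₀).source) : Function.Injective (dTot p₀ q) := by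
  obtain ⟨e, he⟩ := isInvertible_dTot hq
  rw [← he]; exact e.injective

theorem dTot_surjective (hq : q ∈ (chartTM p₀).source) : Function.Surjective (dTot p₀ q) := by
  obtain ⟨e, he⟩ := isInvertible_dTot hq
  rw [← he]; exact e.surjective

theorem fst_dTot (hq : q ∈ (chartTM p₀).source) (w : TTM n M q) :
    (dTot p₀ q w).1 = dBase p₀ q (dproj q w) := by
  have := isManifold_one (n := n) (M := M)
  have := isManifold_one_TM (n := n) (M := M)
  have h1 : MDifferentiableAt (𝓡 n).tangent 𝓘(ℝ, EuclideanSpace ℝ (Fin n) × EuclideanSpace ℝ (Fin n))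
      (chartTM p₀) q := mdifferentiableAt_extChartAt (by simpa using hq)
  have h2 : MDifferentiableAt (𝓡 n) 𝓘(ℝ, EuclideanSpace ℝ (Fin n)) (extChartAt (𝓡 n) p₀.1) q.1 :=
    mdifferentiableAt_extChartAt (mem_chartTM_source.1 hq)
  have h3 : MDifferentiableAt (𝓡 n).tangent (𝓡 n) (fun q : TM n M => q.1) q :=
    (Bundle.contMDiffAt_proj (n := ∞) (TangentSpace (𝓡 n))).mdifferentiableAt (by simp)
  have e1 := mfderiv_comp q (g := (Prod.fst : EuclideanSpace ℝ (Fin n) × EuclideanSpace ℝ (Fin n) → _))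
    (I' := 𝓘(ℝ, EuclideanSpace ℝ (Fin n) × EuclideanSpace ℝ (Fin n)))
    (I'' := 𝓘(ℝ, EuclideanSpace ℝ (Fin n)))
    differentiableAt_fst.mdifferentiableAt h1
  have e2 := mfderiv_comp q h2 h3
  have e3 : (Prod.fst ∘ chartTM p₀) =ᶠ[𝓝 q] (extChartAt (𝓡 n) p₀.1) ∘ (fun q : TM n M => q.1) := by
    filter_upwards [(isOpen_extChartAt_source p₀).mem_nhds hq] with x hx
    exact congrArg Prod.fst (chartTM_apply hx)
  have e4 := e3.mfderiv_eq (I := (𝓡 n).tangent) (I' := 𝓘(ℝ, EuclideanSpace ℝ (Fin n)))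
  rw [e1, e2, mfderiv_eq_fderiv, fderiv_fst] at e4
  exact congrArg (fun L => L w) e4

theorem contMDiffAt_fibreIncl (x : M) (y : EuclideanSpace ℝ (Fin n)) :
    ContMDiffAt 𝓘(ℝ, EuclideanSpace ℝ (Fin n)) (𝓡 n).tangent ∞ (fibreIncl (n := n) x) y := by
  have := isManifold_one (n := n) (M := M)
  refine (Bundle.contMDiffAt_totalSpace (E := TangentSpace (𝓡 n)) (IB := 𝓡 n)).2
    ⟨contMDiffAt_const, ?_⟩
  have : (fun y => ((trivializationAt (EuclideanSpace ℝ (Fin n)) (TangentSpace (𝓡 n)) x)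
      (fibreIncl (n := n) x y)).2) = fun y => dchart (𝓡 n) x x y := by
    funext y
    exact (dchart_apply (mem_chart_source _ x) _).symm
  refine ContMDiffAt.congr_of_eventuallyEq ?_ (Filter.Eventually.of_forall (congrFun this))
  let A : EuclideanSpace ℝ (Fin n) →L[ℝ] EuclideanSpace ℝ (Fin n) := dchart (𝓡 n) x x
  exact contMDiffAt_iff_contDiffAt.2 A.contDiff.contDiffAt

/-- Restricted to one fibre, the chart of TM is constant in x and linear in y. -/
theorem dTot_vlift (hq : q ∈ (chartTM p₀).source) (w : TangentSpace (𝓡 n) q.1) :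
    dTot p₀ q (vlift q w) = (0, dBase p₀ q w) := by
  have := isManifold_one_TM (n := n) (M := M)
  have h1 : MDifferentiableAt (𝓡 n).tangent 𝓘(ℝ, EuclideanSpace ℝ (Fin n) × EuclideanSpace ℝ (Fin n))
      (chartTM p₀) (fibreIncl q.1 q.2) :=
    mdifferentiableAt_extChartAt (by simpa using! mem_chartTM_source.1 hq)
  let A : EuclideanSpace ℝ (Fin n) →L[ℝ] EuclideanSpace ℝ (Fin n) := dBase p₀ q
  let y : EuclideanSpace ℝ (Fin n) := q.2
  have h2 := (contMDiffAt_fibreIncl (n := n) q.1 y).mdifferentiableAt (by simp)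
  have e1 := mfderiv_comp y h1 h2
  have e3 : (chartTM p₀ ∘ fibreIncl q.1) =
      fun y => (extChartAt (𝓡 n) p₀.1 q.1, A y) := by
    funext y
    exact chartTM_apply (q := fibreIncl q.1 y) (mem_chartTM_source.2 (mem_chartTM_source.1 hq))
  have e4 := (hasFDerivAt_const (extChartAt (𝓡 n) p₀.1 q.1) y).prodMk
    (A.hasFDerivAt (x := y))
  have e5 := e4.hasMFDerivAt.mfderiv
  rw [← e3] at e5
  rw [e5] at e1
  exact (congrArg (fun L => L w) e1).symm

theorem dTot_tangentStr (hq : q ∈ (chartTM p₀).source) (w : TTM n M q) :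
    dTot p₀ q (tangentStr q w) = (0, (dTot p₀ q w).1) := by
  rw [fst_dTot hq]
  exact dTot_vlift hq _

theorem dTot_liouville (hq : q ∈ (chartTM p₀).source) :
    dTot p₀ q (liouville q) = (0, (chartTM p₀ q).2) := by
  rw [chartTM_apply hq]
  exact dTot_vlift hq _

theorem mem_slit_iff (hq : q ∈ (chartTM p₀).source) : q ∈ slit n M ↔ (chartTM p₀ q).2 ≠ 0 := by
  rw [chartTM_apply hq]
  obtain ⟨e, he⟩ := isInvertible_dBase hq
  rw [← he]
  exact (e.map_ne_zero_iff (x := q.2)).symm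

theorem isOpen_slit : IsOpen (slit n M) := by
  rw [isOpen_iff_mem_nhds]
  intro p hp
  have h0 := mem_extChartAt_source (I := (𝓡 n).tangent) p
  have h1 : ContinuousAt (fun q => (chartTM p q).2) p :=
    (continuousAt_extChartAt (I := (𝓡 n).tangent) p).snd
  filter_upwards [extChartAt_source_mem_nhds (I := (𝓡 n).tangent) p,
    h1.eventually_ne ((mem_slit_iff h0).1 hp)] with q hq h2
  exact (mem_slit_iff hq).2 h2

/-! ### Operations on fields in coordinates -/

variable {X Y S : VField n M}

theorem rep_apply (hq : q ∈ (chartTM p₀).source) (X : VField n M) :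
    rep p₀ X (chartTM p₀ q) = dTot p₀ q (X q) := field_apply hq X

theorem chartTM_target_mem_nhds (hq : q ∈ (chartTM p₀).source) :
    (chartTM p₀).target ∈ 𝓝 (chartTM p₀ q) :=
  target_mem_nhds ((chartTM p₀).map_source hq)

/-- The coordinates of the points of a neighbourhood of `q` are the points of a neighbourhood. -/
theorem eventually_chartTM (hq : q ∈ (chartTM p₀).source) {P : TM n M → Prop}
    (h : ∀ᶠ q' in 𝓝 q, P q') :
    ∀ᶠ z in 𝓝 (chartTM p₀ q), ∃ q' ∈ (chartTM p₀).source, z = chartTM p₀ q' ∧ P q' := by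
  have h1 := ((contMDiffAt_symm ((chartTM p₀).map_source hq)).continuousAt).eventually
    (p := P) (by rwa [(chartTM p₀).left_inv hq])
  filter_upwards [h1, chartTM_target_mem_nhds hq] with z hz hz2
  exact ⟨(chartTM p₀).symm z, (chartTM p₀).map_target hz2, ((chartTM p₀).right_inv hz2).symm, hz⟩

theorem rep_J (hq : q ∈ (chartTM p₀).source) (X : VField n M) :
    rep p₀ (J X) =ᶠ[𝓝 (chartTM p₀ q)] fun z => (0, (rep p₀ X z).1) := by
  filter_upwards [eventually_chartTM hq (Filter.univ_mem)] with z hz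
  obtain ⟨q', hq', rfl, -⟩ := hz
  rw [rep_apply hq', rep_apply hq']
  exact dTot_tangentStr hq' _

theorem rep_bracket (hq : q ∈ (chartTM p₀).source)
    (hX : SmoothNear (rep p₀ X) (chartTM p₀ q)) (hY : SmoothNear (rep p₀ Y) (chartTM p₀ q)) :
    rep p₀ (bracket X Y) =ᶠ[𝓝 (chartTM p₀ q)] VectorField.lieBracket ℝ (rep p₀ X) (rep p₀ Y) := by
  filter_upwards [chartTM_target_mem_nhds hq, hX, hY] with z hz h1 h2
  exact field_mlieBracket hz h1 h2

theorem smoothNear_rep (hq : q ∈ (chartTM p₀).source)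
    (hX : ∀ᶠ q' in 𝓝 q, ContMDiffAt (𝓡 n).tangent (𝓡 n).tangent.tangent ∞
      (fun p => (⟨p, X p⟩ : TangentBundle (𝓡 n).tangent (TM n M))) q') :
    SmoothNear (rep p₀ X) (chartTM p₀ q) := by
  filter_upwards [eventually_chartTM hq hX] with z hz
  obtain ⟨q', hq', rfl, h⟩ := hz
  exact (contMDiffAt_iff_field hq').1 h

theorem smoothNear_rep_ext (hq : q ∈ (chartTM p₀).source) (w : TTM n M q) :
    SmoothNear (rep p₀ (ext w)) (chartTM p₀ q) := by
  refine smoothNear_rep hq ?_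
  obtain ⟨s, hs, h⟩ := FiberBundle.exists_contMDiffOn_extend (k := ∞) (𝓡 n).tangent
    (EuclideanSpace ℝ (Fin n) × EuclideanSpace ℝ (Fin n))
    (V := fun p : TM n M => TangentSpace (𝓡 n).tangent p) w
  filter_upwards [eventually_mem_nhds_iff.2 hs] with q' hq'
  exact h.contMDiffAt hq'

theorem rep_ext (hq : q ∈ (chartTM p₀).source) (w : TTM n M q) :
    rep p₀ (ext w) (chartTM p₀ q) = dTot p₀ q w := by
  rw [rep_apply hq, ext, FiberBundle.extend_apply_self]

theorem smoothNear_repf (hq : q ∈ (chartTM p₀).source) (hs : q ∈ slit n M) {f : TM n M → ℝ}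
    (hf : ContMDiffOn (𝓡 n).tangent 𝓘(ℝ, ℝ) ∞ f (slit n M)) :
    SmoothNear (repf p₀ f) (chartTM p₀ q) := by
  have h : ∀ᶠ q' in 𝓝 q, q' ∈ slit n M := isOpen_slit.mem_nhds hs
  filter_upwards [eventually_chartTM hq h] with z hz
  obtain ⟨q', hq', rfl, h⟩ := hz
  exact (contMDiffAt_iff_func hq' le_rfl).1 (hf.contMDiffAt (isOpen_slit.mem_nhds h))

theorem IsSpray.smoothNear (hS : IsSpray S) (hq : q ∈ (chartTM p₀).source) (hs : q ∈ slit n M) :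
    SmoothNear (rep p₀ S) (chartTM p₀ q) := by
  refine smoothNear_rep hq ?_
  filter_upwards [isOpen_slit.mem_nhds hs] with q' hq'
  exact hS.smooth.contMDiffAt (isOpen_slit.mem_nhds hq')

theorem IsSpray.isSecondOrder (hS : IsSpray S) (hq : q ∈ (chartTM p₀).source)
    (hs : q ∈ slit n M) : IsSecondOrder (rep p₀ S) (chartTM p₀ q) := by
  have h : ∀ᶠ q' in 𝓝 q, q' ∈ slit n M := isOpen_slit.mem_nhds hs
  filter_upwards [eventually_chartTM hq h] with z hz
  obtain ⟨q', hq', rfl, h⟩ := hz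
  have h1 := congrArg (dTot p₀ q') (hS.tangentStr_eq q' h)
  rw [dTot_tangentStr hq', dTot_liouville hq', ← rep_apply hq'] at h1
  exact congrArg Prod.snd h1

theorem rep_liouville (hq : q ∈ (chartTM p₀).source) :
    rep p₀ liouville =ᶠ[𝓝 (chartTM p₀ q)] fun z => (0, z.2) := by
  filter_upwards [eventually_chartTM hq (Filter.univ_mem)] with z hz
  obtain ⟨q', hq', rfl, -⟩ := hz
  rw [rep_apply hq', dTot_liouville hq']

/-- The vertical component of [ℂ,S] = S is Euler's relation of degree two for the coefficients of S:
−2N y is twice that component. Thus S is horizontal. -/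
theorem IsSpray.rep_eq (hS : IsSpray S) (hq : q ∈ (chartTM p₀).source) (hs : q ∈ slit n M) :
    rep p₀ S (chartTM p₀ q) =
      ((chartTM p₀ q).2, -conn (rep p₀ S) (chartTM p₀ q) (chartTM p₀ q).2) := by
  have hC : HasFDerivAt (rep p₀ liouville) ((0 : _ →L[ℝ] EuclideanSpace ℝ (Fin n)).prod
      (ContinuousLinearMap.snd ℝ _ _)) (chartTM p₀ q) :=
    HasFDerivAt.congr_of_eventuallyEq ((hasFDerivAt_const _ _).prodMk
      hasFDerivAt_snd) (rep_liouville hq)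
  have hCs : SmoothNear (rep p₀ liouville) (chartTM p₀ q) :=
    SmoothNear.congr (Filter.Eventually.of_forall fun _ =>
      (contDiff_const.prodMk contDiff_snd).contDiffAt) (rep_liouville hq)
  have h1 := congrArg (dTot p₀ q) (hS.bracket_eq q hs)
  rw [← rep_apply hq, ← rep_apply hq, (rep_bracket hq hCs (hS.smoothNear hq hs)).self_of_nhds,
    VectorField.lieBracket, hC.fderiv, (rep_liouville hq).self_of_nhds,
    fderiv_secondOrder (hS.smoothNear hq hs).differentiableAt (hS.isSecondOrder hq hs)] at h1
  have h2 : baseDeriv (rep p₀ S) (chartTM p₀ q) 0 -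
      (2 : ℝ) • conn (rep p₀ S) (chartTM p₀ q) (chartTM p₀ q).2 - (rep p₀ S (chartTM p₀ q)).2 =
      (rep p₀ S (chartTM p₀ q)).2 := congrArg Prod.snd h1
  refine Prod.ext (hS.isSecondOrder hq hs).self_of_nhds ?_
  rw [map_zero, zero_sub, sub_eq_iff_eq_add, ← two_smul ℝ, ← smul_neg] at h2
  exact (smul_right_injective _ two_ne_zero h2).symm

end SprayGeometry

/-! ### The projectors and the Jacobi endomorphism in coordinates -/

namespace SprayGeometry

open ChartRep SprayCoord VectorField

variable {n : ℕ} {M : Type*} [TopologicalSpace M] [ChartedSpace (EuclideanSpace ℝ (Fin n)) M]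
  [IsManifold (𝓡 n) ∞ M] {p₀ q : TM n M} {X Y S : VField n M} {f : TM n M → ℝ}

theorem rep_sub (p₀ : TM n M) (X Y : VField n M)
    (z : EuclideanSpace ℝ (Fin n) × EuclideanSpace ℝ (Fin n)) :
    rep p₀ (X - Y) z = rep p₀ X z - rep p₀ Y z := map_sub (dTot p₀ ((chartTM p₀).symm z)) _ _

theorem rep_add (p₀ : TM n M) (X Y : VField n M)
    (z : EuclideanSpace ℝ (Fin n) × EuclideanSpace ℝ (Fin n)) :
    rep p₀ (X + Y) z = rep p₀ X z + rep p₀ Y z := map_add (dTot p₀ ((chartTM p₀).symm z)) _ _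

theorem rep_smul (p₀ : TM n M) (c : ℝ) (X : VField n M)
    (z : EuclideanSpace ℝ (Fin n) × EuclideanSpace ℝ (Fin n)) :
    rep p₀ (c • X) z = c • rep p₀ X z := map_smul (dTot p₀ ((chartTM p₀).symm z)) _ _

/-- A property valid at the points of `T₀M` holds near the coordinates of such a point. -/
theorem eventually_of_slit (hq : q ∈ (chartTM p₀).source) (hs : q ∈ slit n M)
    {P : EuclideanSpace ℝ (Fin n) × EuclideanSpace ℝ (Fin n) → Prop}
    (h : ∀ q' ∈ (chartTM p₀).source, q' ∈ slit n M → P (chartTM p₀ q')) :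
    ∀ᶠ z in 𝓝 (chartTM p₀ q), P z := by
  filter_upwards [eventually_chartTM hq (isOpen_slit.mem_nhds hs)] with z hz
  obtain ⟨q', hq', rfl, h'⟩ := hz
  exact h q' hq' h'

theorem rep_lieDer_J (hS : IsSpray S) (hq : q ∈ (chartTM p₀).source) (hs : q ∈ slit n M)
    (hX : SmoothNear (rep p₀ X) (chartTM p₀ q)) :
    rep p₀ (lieDer S J X) (chartTM p₀ q) =
      (-(rep p₀ X (chartTM p₀ q)).1,
        (2 : ℝ) • conn (rep p₀ S) (chartTM p₀ q) (rep p₀ X (chartTM p₀ q)).1 +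
          (rep p₀ X (chartTM p₀ q)).2) := by
  have hJ : SmoothNear (rep p₀ (J X)) (chartTM p₀ q) :=
    SmoothNear.congr (SmoothNear.comp_contDiff (contDiff_const.prodMk contDiff_fst) hX)
      (rep_J hq X)
  have hS' := hS.smoothNear hq hs
  rw [lieDer, rep_sub, (rep_bracket hq hS' hJ).self_of_nhds, (rep_J hq _).self_of_nhds]
  beta_reduce
  rw [(rep_bracket hq hS' hX).self_of_nhds,
    Filter.EventuallyEq.lieBracket_vectorField_eq (Filter.EventuallyEq.refl _ _) (rep_J hq X)]
  exact lieBracket_vertical_sub hS'.differentiableAt (hS.isSecondOrder hq hs) hX.differentiableAt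

theorem rep_hor_apply (hS : IsSpray S) (hq : q ∈ (chartTM p₀).source) (hs : q ∈ slit n M)
    (hX : SmoothNear (rep p₀ X) (chartTM p₀ q)) :
    rep p₀ (hor S X) (chartTM p₀ q) = horPart (rep p₀ S) (rep p₀ X) (chartTM p₀ q) := by
  rw [hor, rep_smul, rep_sub, rep_lieDer_J hS hq hs hX, horPart]
  refine Prod.ext ?_ ?_ <;>
    simp only [Prod.smul_fst, Prod.smul_snd, Prod.fst_sub, Prod.snd_sub] <;> module

theorem rep_ver_apply (hS : IsSpray S) (hq : q ∈ (chartTM p₀).source) (hs : q ∈ slit n M)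
    (hX : SmoothNear (rep p₀ X) (chartTM p₀ q)) :
    rep p₀ (ver S X) (chartTM p₀ q) =
      (0, (rep p₀ X (chartTM p₀ q)).2 +
        conn (rep p₀ S) (chartTM p₀ q) (rep p₀ X (chartTM p₀ q)).1) := by
  rw [ver, rep_smul, rep_add, rep_lieDer_J hS hq hs hX]
  refine Prod.ext ?_ ?_ <;>
    simp only [Prod.smul_fst, Prod.smul_snd, Prod.fst_add, Prod.snd_add] <;> module

theorem rep_hor (hS : IsSpray S) (hq : q ∈ (chartTM p₀).source) (hs : q ∈ slit n M)
    (hX : SmoothNear (rep p₀ X) (chartTM p₀ q)) :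
    rep p₀ (hor S X) =ᶠ[𝓝 (chartTM p₀ q)] horPart (rep p₀ S) (rep p₀ X) := by
  have h := eventually_of_slit hq hs (P := fun z => SmoothNear (rep p₀ X) z →
    rep p₀ (hor S X) z = horPart (rep p₀ S) (rep p₀ X) z) fun q' h1 h2 h3 =>
      rep_hor_apply hS h1 h2 h3
  filter_upwards [h, hX.eventually] with z h1 h2 using h1 h2

/-- Since v ∘ h = 0, the term h[S, X] of (L_S h)X drops out, and only v[S, hX] remains. -/
theorem rep_jacobi (hS : IsSpray S) (hq : q ∈ (chartTM p₀).source) (hs : q ∈ slit n M)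
    (hX : SmoothNear (rep p₀ X) (chartTM p₀ q)) :
    rep p₀ (jacobi S X) (chartTM p₀ q) =
      (0, curv (rep p₀ S) (chartTM p₀ q) (rep p₀ X (chartTM p₀ q)).1) := by
  have hS' := hS.smoothNear hq hs
  have hB : SmoothNear (rep p₀ (bracket S X)) (chartTM p₀ q) :=
    (hS'.lieBracket hX).congr (rep_bracket hq hS' hX)
  have hH : SmoothNear (rep p₀ (hor S X)) (chartTM p₀ q) :=
    (smoothNear_horPart hS' hX).congr (rep_hor hS hq hs hX)
  have h1 : rep p₀ (bracket S (hor S X)) =ᶠ[𝓝 (chartTM p₀ q)]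
      lieBracket ℝ (rep p₀ S) (horPart (rep p₀ S) (rep p₀ X)) :=
    (rep_bracket hq hS' hH).trans
      ((Filter.EventuallyEq.refl _ _).lieBracket_vectorField (rep_hor hS hq hs hX))
  have h2 := rep_hor hS hq hs hB
  have hW : rep p₀ (lieDer S (hor S) X) =ᶠ[𝓝 (chartTM p₀ q)] fun z =>
      lieBracket ℝ (rep p₀ S) (horPart (rep p₀ S) (rep p₀ X)) z -
        horPart (rep p₀ S) (rep p₀ (bracket S X)) z := by
    filter_upwards [h1, h2] with z e1 e2
    rw [lieDer, rep_sub, e1, e2]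
  have hWs : SmoothNear (rep p₀ (lieDer S (hor S) X)) (chartTM p₀ q) :=
    ((hS'.lieBracket (smoothNear_horPart hS' hX)).sub (smoothNear_horPart hS' hB)).congr hW
  rw [jacobi, rep_ver_apply hS hq hs hWs, hW.self_of_nhds,
    ← ver_lieBracket_horPart hS' (hS.isSecondOrder hq hs) hX.differentiableAt]
  refine Prod.ext rfl ?_
  simp only [horPart, Prod.fst_sub, Prod.snd_sub, map_sub]
  module

/-- Only the value of the extending field at the point survives, so the choice made in `ext` has no
effect. -/
theorem dTot_jacobi (hS : IsSpray S) (hq : q ∈ (chartTM p₀).source) (hs : q ∈ slit n M)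
    (w : TTM n M q) :
    dTot p₀ q (evalAt (jacobi S) q w) =
      (0, curv (rep p₀ S) (chartTM p₀ q) (dTot p₀ q w).1) := by
  have h := rep_jacobi hS hq hs (smoothNear_rep_ext hq w)
  rw [rep_apply hq, rep_ext hq] at h
  exact h

theorem dTot_hor (hS : IsSpray S) (hq : q ∈ (chartTM p₀).source) (hs : q ∈ slit n M)
    (w : TTM n M q) :
    dTot p₀ q (evalAt (hor S) q w) =
      ((dTot p₀ q w).1, -conn (rep p₀ S) (chartTM p₀ q) (dTot p₀ q w).1) := by
  have h := rep_hor_apply hS hq hs (smoothNear_rep_ext hq w)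
  rw [rep_apply hq, horPart, rep_ext hq] at h
  exact h

/-! ### The trace -/

theorem vlift_injective (q : TM n M) : Function.Injective (vlift q) := by
  have hq := mem_extChartAt_source (I := (𝓡 n).tangent) q
  obtain ⟨e, he⟩ := isInvertible_dBase hq
  intro u w h
  have h1 := congrArg (dTot q q) h
  rw [dTot_vlift hq, dTot_vlift hq, ← he] at h1
  exact e.injective (congrArg Prod.snd h1)

theorem dproj_surjective (q : TM n M) : Function.Surjective (dproj q) := by
  have hq := mem_extChartAt_source (I := (𝓡 n).tangent) q
  obtain ⟨e, he⟩ := isInvertible_dBase hq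
  intro u
  obtain ⟨w, hw⟩ := dTot_surjective hq (dBase q q u, 0)
  refine ⟨w, e.injective ?_⟩
  have h1 := fst_dTot hq w
  rw [hw, ← he] at h1
  exact h1.symm

/-- The chosen endomorphism is unique, because `dproj` is surjective and `vlift` is injective. -/
theorem semibasicTrace_eq {A : TTM n M q → TTM n M q}
    {φ : TangentSpace (𝓡 n) q.1 →ₗ[ℝ] TangentSpace (𝓡 n) q.1}
    (h : ∀ w, A w = vlift q (φ (dproj q w))) :
    semibasicTrace q A = LinearMap.trace ℝ (TangentSpace (𝓡 n) q.1) φ := by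
  have hex : ∃ φ : TangentSpace (𝓡 n) q.1 →ₗ[ℝ] TangentSpace (𝓡 n) q.1,
      ∀ w, A w = vlift q (φ (dproj q w)) := ⟨φ, h⟩
  rw [semibasicTrace, dif_pos hex]
  congr 1
  ext1 u
  obtain ⟨w, rfl⟩ := dproj_surjective q u
  exact vlift_injective q ((hex.choose_spec w).symm.trans (h w))

/-- The coordinate matrix is conjugate, by the differential of the chart of M, to the intrinsic
endomorphism. -/
theorem semibasicTrace_eq_trace (hq : q ∈ (chartTM p₀).source) {A : TTM n M q → TTM n M q}
    {C : EuclideanSpace ℝ (Fin n) →ₗ[ℝ] EuclideanSpace ℝ (Fin n)}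
    (h : ∀ w, dTot p₀ q (A w) = (0, C (dTot p₀ q w).1)) :
    semibasicTrace q A = LinearMap.trace ℝ (EuclideanSpace ℝ (Fin n)) C := by
  obtain ⟨e, he⟩ := isInvertible_dBase hq
  rw [semibasicTrace_eq (φ := e.symm.toLinearEquiv.conj C)]
  · exact LinearMap.trace_conj' _ _
  · intro w
    refine dTot_injective hq ?_
    rw [h, dTot_vlift hq, fst_dTot hq, ← he]
    simp [LinearEquiv.conj_apply]

/-- The trace as a continuous linear form. -/
def traceCLM (n : ℕ) :
    (EuclideanSpace ℝ (Fin n) →L[ℝ] EuclideanSpace ℝ (Fin n)) →L[ℝ] ℝ :=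
  LinearMap.toContinuousLinearMap
    ((LinearMap.trace ℝ (EuclideanSpace ℝ (Fin n))).comp (ContinuousLinearMap.coeLM ℝ))

theorem ricci_eq (hS : IsSpray S) (hq : q ∈ (chartTM p₀).source) (hs : q ∈ slit n M) :
    ricci S q = traceCLM n (curv (rep p₀ S) (chartTM p₀ q)) :=
  semibasicTrace_eq_trace hq fun w => dTot_jacobi hS hq hs w

theorem repf_apply (hq : q ∈ (chartTM p₀).source) (f : TM n M → ℝ) :
    repf p₀ f (chartTM p₀ q) = f q := func_apply hq f

theorem smoothNear_ricci (hS : IsSpray S) (hq : q ∈ (chartTM p₀).source) (hs : q ∈ slit n M) :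
    SmoothNear (repf p₀ (ricci S)) (chartTM p₀ q) := by
  have h : SmoothNear (fun z => traceCLM n (curv (rep p₀ S) z)) (chartTM p₀ q) :=
    (smoothNear_curv (hS.smoothNear hq hs)).comp_contDiff (traceCLM n).contDiff
  refine h.congr (eventually_of_slit hq hs fun q' h1 h2 => ?_)
  rw [repf_apply h1, ricci_eq hS h1 h2]

theorem contMDiffOn_ricci (hS : IsSpray S) :
    ContMDiffOn (𝓡 n).tangent 𝓘(ℝ, ℝ) ∞ (ricci S) (slit n M) := fun q hs =>
  ((contMDiffAt_iff_func (mem_extChartAt_source q) le_rfl).2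
    (smoothNear_ricci hS (mem_extChartAt_source q) hs).contDiffAt).contMDiffWithinAt

/-! ### Differentials in coordinates -/

theorem diff_eq (hq : q ∈ (chartTM p₀).source) (hf : SmoothNear (repf p₀ f) (chartTM p₀ q))
    (w : TTM n M q) :
    diff f q w = fderiv ℝ (repf p₀ f) (chartTM p₀ q) (dTot p₀ q w) :=
  mfderiv_eq_func hq hf.differentiableAt w

theorem dJ_eq (hq : q ∈ (chartTM p₀).source) (hf : SmoothNear (repf p₀ f) (chartTM p₀ q))
    (w : TTM n M q) :
    dJ f q w = fderiv ℝ (repf p₀ f) (chartTM p₀ q) (0, (dTot p₀ q w).1) := by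
  rw [← dTot_tangentStr hq]
  exact diff_eq hq hf _

theorem repf_dJ (hq : q ∈ (chartTM p₀).source) (hf : SmoothNear (repf p₀ f) (chartTM p₀ q))
    (X : VField n M) :
    repf p₀ (fun q => dJ f q (X q)) =ᶠ[𝓝 (chartTM p₀ q)]
      fun z => fderiv ℝ (repf p₀ f) z (0, (rep p₀ X z).1) := by
  filter_upwards [eventually_chartTM hq Filter.univ_mem, hf.eventually] with z hz h
  obtain ⟨q', hq', rfl, -⟩ := hz
  rw [repf_apply hq', dJ_eq hq' h, rep_apply hq']

theorem extDer_dJ (hq : q ∈ (chartTM p₀).source) (hf : SmoothNear (repf p₀ f) (chartTM p₀ q))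
    (u w : TTM n M q) :
    extDer (dJ f) q u w =
      twoForm (repf p₀ f) (chartTM p₀ q) (dTot p₀ q u) (dTot p₀ q w) := by
  have hu := smoothNear_rep_ext hq u
  have hw := smoothNear_rep_ext hq w
  have hsm : ∀ {X : VField n M}, SmoothNear (rep p₀ X) (chartTM p₀ q) →
      SmoothNear (repf p₀ (fun q => dJ f q (X q))) (chartTM p₀ q) := fun {X} hX =>
    (hf.fderiv.clm_apply (SmoothNear.comp_contDiff (contDiff_const.prodMk contDiff_fst) hX)).congr
      (repf_dJ hq hf X)
  have e := exteriorDeriv_dJ hf hu.differentiableAt hw.differentiableAt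
  rw [rep_ext hq, rep_ext hq] at e
  rw [extDer, diff_eq hq (hsm hw), diff_eq hq (hsm hu), (repf_dJ hq hf _).fderiv_eq,
    (repf_dJ hq hf _).fderiv_eq, dJ_eq hq hf, ← rep_apply hq, (rep_bracket hq hu hw).self_of_nhds]
  exact e

end SprayGeometry

/-! ### Full rank as nondegeneracy -/

namespace SprayCoord

theorem finrank_range_eq_iff {V W : Type*} [AddCommGroup V] [Module ℝ V] [FiniteDimensional ℝ V]
    [AddCommGroup W] [Module ℝ W] (Λ : V →ₗ[ℝ] W) :
    Module.finrank ℝ (LinearMap.range Λ) = Module.finrank ℝ V ↔ ∀ u, Λ u = 0 → u = 0 := by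
  rw [← LinearMap.finrank_range_add_finrank_ker Λ, eq_comm, Nat.add_eq_left,
    Submodule.finrank_eq_zero, LinearMap.ker_eq_bot']

/-- The forms B(u, ·) already make up a subspace, the range of a linear map, so rank–nullity
applies. -/
theorem formRank_eq_iff {V : Type*} [AddCommGroup V] [Module ℝ V] [FiniteDimensional ℝ V]
    (Λ : V →ₗ[ℝ] V → ℝ) {B : V → V → ℝ} (hB : ∀ u w, B u w = Λ u w) :
    SprayGeometry.formRank B = Module.finrank ℝ V ↔ ∀ u, (∀ w, B u w = 0) → u = 0 := by
  have e : B = Λ := by funext u w; exact hB u w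
  have h1 : Submodule.span ℝ (Set.range B) = LinearMap.range Λ := by
    rw [e, ← LinearMap.coe_range, Submodule.span_eq]
  rw [SprayGeometry.formRank, h1, finrank_range_eq_iff]
  simp only [hB, funext_iff, Pi.zero_apply]

variable {V : Type*} [NormedAddCommGroup V] [NormedSpace ℝ V] {L : V × V → ℝ} {z : V × V}

theorem twoForm_add (z u u' w : V × V) :
    twoForm L z (u + u') w = twoForm L z u w + twoForm L z u' w := by
  have : ((0 : V), (u + u').1) = (0, u.1) + (0, u'.1) := by simp
  rw [twoForm, this, map_add, map_add, twoForm, twoForm, _root_.add_apply]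
  ring

theorem twoForm_smul (z u w : V × V) (t : ℝ) :
    twoForm L z (t • u) w = t • twoForm L z u w := by
  have : ((0 : V), (t • u).1) = t • (0, u.1) := by simp
  rw [twoForm, this, map_smul, map_smul, twoForm, _root_.smul_apply, smul_sub]

/-- The fibre Hessian of `L / 2`. -/
theorem fderiv_fderiv_fibre {x y : V} (hL : SmoothNear L (x, y)) (b c : V) :
    fderiv ℝ (fderiv ℝ (fun y => L (x, y) / 2)) y b c =
      fderiv ℝ (fderiv ℝ L) (x, y) (0, b) (0, c) / 2 := by
  have hi : ∀ y : V, HasFDerivAt (fun y => (x, y)) (ContinuousLinearMap.inr ℝ V V) y := fun y =>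
    (hasFDerivAt_const x y).prodMk (hasFDerivAt_id y)
  have hev : ∀ᶠ y' in 𝓝 y, ContDiffAt ℝ ∞ L (x, y') :=
    (hi y).continuousAt.eventually hL
  -- The fibre differential is the image of the full differential of L under one fixed linear map, ½
  -- times composition with `inr`; a second use of the chain rule then gives the Hessian.
  have h1 : fderiv ℝ (fun y => L (x, y) / 2) =ᶠ[𝓝 y] fun y =>
      ((1 / 2 : ℝ) • ContinuousLinearMap.compL ℝ V (V × V) ℝ).flip
        (ContinuousLinearMap.inr ℝ V V) (fderiv ℝ L (x, y)) := by
    filter_upwards [hev] with y' h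
    have e := ((h.differentiableAt (by simp)).hasFDerivAt.comp y' (hi y')).mul_const (1 / 2 : ℝ)
    have e' : HasFDerivAt (fun y => L (x, y) / 2) _ y' := e.congr_of_eventuallyEq
      (Filter.Eventually.of_forall fun t => by simp [div_eq_mul_inv])
    rw [e'.fderiv]
    ext v
    simp
  have e2 : HasFDerivAt (fun y => fderiv ℝ L (x, y)) _ y :=
    (hL.fderiv.differentiableAt.hasFDerivAt).comp y (hi y)
  have e3 := (((1 / 2 : ℝ) • ContinuousLinearMap.compL ℝ V (V × V) ℝ).flip
    (ContinuousLinearMap.inr ℝ V V)).hasFDerivAt.comp y e2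
  rw [h1.fderiv_eq]
  refine (congrArg (fun T => T b c) e3.fderiv).trans ?_
  simp
  ring

end SprayCoord

/-! ### The conditions (A), (D1), (D2) when Ric = c F² -/

namespace SprayGeometry

open ChartRep SprayCoord VectorField

variable {n : ℕ} {M : Type*} [TopologicalSpace M] [ChartedSpace (EuclideanSpace ℝ (Fin n)) M]
  [IsManifold (𝓡 n) ∞ M] {p₀ q : TM n M} {S : VField n M} {f F : TM n M → ℝ}

theorem dBase_self (q : TM n M) (w : TangentSpace (𝓡 n) q.1) : dBase q q w = w := by
  have := isManifold_one (n := n) (M := M)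
  exact congrArg (fun L => L w) (mfderiv_extChartAt_self (I := 𝓡 n) (x := q.1))

theorem chartTM_fibreIncl (q : TM n M) (y : EuclideanSpace ℝ (Fin n)) :
    chartTM q (fibreIncl q.1 y) = (extChartAt (𝓡 n) q.1 q.1, y) := by
  have hq : fibreIncl q.1 y ∈ (chartTM q).source := mem_chartTM_source.2 (mem_chart_source _ q.1)
  exact (chartTM_apply hq).trans (Prod.ext rfl (dBase_self q y))

/-- The differential of the chart is an isomorphism, so degeneracy can be tested in coordinates,
where it reduces to the fibre Hessian. -/
theorem formRank_extDer_iff (hq : q ∈ (chartTM p₀).source)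
    (hf : SmoothNear (repf p₀ f) (chartTM p₀ q)) :
    formRank (extDer (dJ f) q) = 2 * n ↔
      ∀ b, (∀ c, fderiv ℝ (fderiv ℝ (repf p₀ f)) (chartTM p₀ q) (0, b) (0, c) = 0) → b = 0 := by
  let Λ : (EuclideanSpace ℝ (Fin n) × EuclideanSpace ℝ (Fin n)) →ₗ[ℝ] (TTM n M q → ℝ) :=
    { toFun u w := twoForm (repf p₀ f) (chartTM p₀ q) u (dTot p₀ q w)
      map_add' u u' := by funext w; exact twoForm_add _ _ _ _
      map_smul' t u := by funext w; exact twoForm_smul _ _ _ _ }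
  have hdim : Module.finrank ℝ (TTM n M q) = 2 * n := by
    have h : Module.finrank ℝ (EuclideanSpace ℝ (Fin n) × EuclideanSpace ℝ (Fin n)) = 2 * n := by
      rw [Module.finrank_prod, finrank_euclideanSpace_fin, two_mul]
    exact h
  have : FiniteDimensional ℝ (TTM n M q) :=
    inferInstanceAs (FiniteDimensional ℝ (EuclideanSpace ℝ (Fin n) × EuclideanSpace ℝ (Fin n)))
  rw [← hdim, formRank_eq_iff (Λ.comp (dTot p₀ q).toLinearMap) fun u w => extDer_dJ hq hf u w,
    ← twoForm_nondegenerate_iff hf]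
  simp only [extDer_dJ hq hf]
  constructor
  · intro h u hu
    obtain ⟨u, rfl⟩ := dTot_surjective hq u
    rw [h u fun w => hu _, map_zero]
  · intro h u hu
    refine dTot_injective hq ?_
    rw [map_zero]
    refine h _ fun w => ?_
    obtain ⟨w, rfl⟩ := dTot_surjective hq w
    exact hu w

theorem contMDiffOn_sq (hF : ContMDiffOn (𝓡 n).tangent 𝓘(ℝ, ℝ) ∞ F (slit n M)) :
    ContMDiffOn (𝓡 n).tangent 𝓘(ℝ, ℝ) ∞ (fun q => F q ^ 2) (slit n M) := by
  have h : ContMDiff 𝓘(ℝ, ℝ) 𝓘(ℝ, ℝ) ∞ (fun x : ℝ => x ^ 2) := (contDiff_id.pow 2).contMDiff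
  exact h.comp_contMDiffOn hF

/-- In the chart centred at q the induced coordinate on the fibre through q is the identity, so the
intrinsic and the coordinate Hessians coincide up to the factor ½. -/
theorem rank_metric_iff (hF : ContMDiffOn (𝓡 n).tangent 𝓘(ℝ, ℝ) ∞ F (slit n M))
    (hs : q ∈ slit n M) :
    Module.finrank ℝ (LinearMap.range
      (fderiv ℝ (fderiv ℝ (fun y : EuclideanSpace ℝ (Fin n) =>
        F (fibreIncl q.1 y) ^ 2 / 2)) q.2).toLinearMap) = n ↔
    ∀ b, (∀ c, fderiv ℝ (fderiv ℝ (repf q (fun q => F q ^ 2))) (chartTM q q) (0, b) (0, c) = 0) →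
      b = 0 := by
  have hq := mem_extChartAt_source (I := (𝓡 n).tangent) q
  have hL := smoothNear_repf hq hs (contMDiffOn_sq hF)
  have hz : chartTM q q = (extChartAt (𝓡 n) q.1 q.1, q.2) := chartTM_fibreIncl q q.2
  have e : (fun y : EuclideanSpace ℝ (Fin n) => F (fibreIncl q.1 y) ^ 2 / 2) =
      fun y => repf q (fun q => F q ^ 2) (extChartAt (𝓡 n) q.1 q.1, y) / 2 := by
    funext y
    rw [← chartTM_fibreIncl, repf_apply]
    exact mem_chartTM_source.2 (mem_chart_source _ q.1)
  rw [e, hz]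
  rw [hz] at hL
  have h := finrank_range_eq_iff (fderiv ℝ (fderiv ℝ (fun y : EuclideanSpace ℝ (Fin n) =>
    repf q (fun q => F q ^ 2) (extChartAt (𝓡 n) q.1 q.1, y) / 2)) q.2).toLinearMap
  rw [finrank_euclideanSpace_fin] at h
  refine h.trans (forall_congr' fun b => imp_congr_left ?_)
  rw [ContinuousLinearMap.coe_coe, ContinuousLinearMap.ext_iff]
  refine forall_congr' fun c => ?_
  have := fderiv_fderiv_fibre hL b c
  rw [_root_.zero_apply]
  refine (Eq.congr_left this).trans ?_
  rw [div_eq_zero_iff, or_iff_left two_ne_zero]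
  exact Iff.rfl

theorem dJ_sq (hF : ContMDiffOn (𝓡 n).tangent 𝓘(ℝ, ℝ) ∞ F (slit n M)) (hs : q ∈ slit n M)
    (w : TTM n M q) : dJ (fun q => F q ^ 2) q w = 2 * (F q * dJ F q w) := by
  have hq := mem_extChartAt_source (I := (𝓡 n).tangent) q
  have h1 := smoothNear_repf hq hs hF
  rw [dJ_eq hq (smoothNear_repf hq hs (contMDiffOn_sq hF)), dJ_eq hq h1]
  have e : HasFDerivAt (repf q (fun q => F q ^ 2)) _ (chartTM q q) :=
    h1.differentiableAt.hasFDerivAt.pow 2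
  rw [e.fderiv, repf_apply hq]
  simp
  ring

theorem smoothNear_const_mul {V : Type*} [NormedAddCommGroup V] [NormedSpace ℝ V] {L : V → ℝ}
    {z : V} (c : ℝ) (hL : SmoothNear L z) : SmoothNear (fun z => c * L z) z := by
  filter_upwards [hL] with z' h
  exact contDiffAt_const.mul h

/-- The flag curvature condition in terms of `F²`. -/
theorem hasConstantFlagCurvature_iff (hF : ContMDiffOn (𝓡 n).tangent 𝓘(ℝ, ℝ) ∞ F (slit n M))
    {κ : ℝ} :
    HasConstantFlagCurvature F S κ ↔ ∀ p ∈ slit n M, ∀ w : TTM n M p,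
      evalAt (jacobi S) p w = κ • (F p ^ 2 • tangentStr p w -
        (dJ (fun q => F q ^ 2) p w / 2) • liouville p) := by
  refine forall₂_congr fun p hp => forall_congr' fun w => ?_
  rw [dJ_sq hF hp, mul_div_cancel_left₀ _ two_ne_zero]

/-- The hypothesis Ric = cF² holds for a metric of constant flag curvature by taking traces, and for
√|R| by construction. The equivalences derived from it therefore serve both directions of the
theorem. -/
theorem repf_ricci_eq {c : ℝ} (hc : ∀ p ∈ slit n M, ricci S p = c * F p ^ 2)
    (hq : q ∈ (chartTM p₀).source) (hs : q ∈ slit n M) :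
    repf p₀ (ricci S) =ᶠ[𝓝 (chartTM p₀ q)] fun z => c * repf p₀ (fun q => F q ^ 2) z :=
  eventually_of_slit hq hs fun q' h1 h2 => by
    beta_reduce
    rw [repf_apply h1, repf_apply h1, hc q' h2]

theorem fderiv_repf_ricci {c : ℝ} (hc : ∀ p ∈ slit n M, ricci S p = c * F p ^ 2)
    (hF : ContMDiffOn (𝓡 n).tangent 𝓘(ℝ, ℝ) ∞ F (slit n M))
    (hq : q ∈ (chartTM p₀).source) (hs : q ∈ slit n M) :
    fderiv ℝ (repf p₀ (ricci S)) =ᶠ[𝓝 (chartTM p₀ q)] fun z =>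
      c • fderiv ℝ (repf p₀ (fun q => F q ^ 2)) z := by
  filter_upwards [(repf_ricci_eq hc hq hs).eventuallyEq_nhds,
    smoothNear_repf hq hs (contMDiffOn_sq hF)] with z h1 h2
  rw [h1.fderiv_eq, fderiv_const_mul (h2.differentiableAt (by simp))]

theorem smoothNear_ricci_of_eq {c : ℝ} (hc : ∀ p ∈ slit n M, ricci S p = c * F p ^ 2)
    (hF : ContMDiffOn (𝓡 n).tangent 𝓘(ℝ, ℝ) ∞ F (slit n M))
    (hq : q ∈ (chartTM p₀).source) (hs : q ∈ slit n M) :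
    SmoothNear (repf p₀ (ricci S)) (chartTM p₀ q) :=
  (smoothNear_const_mul c (smoothNear_repf hq hs (contMDiffOn_sq hF))).congr
    (repf_ricci_eq hc hq hs)

/-- Both ranks are maximal exactly when the fibre Hessian of F² is nondegenerate, which the factor c
≠ 0 does not affect. -/
theorem condA_iff {c : ℝ} (hc : ∀ p ∈ slit n M, ricci S p = c * F p ^ 2)
    (hF : ContMDiffOn (𝓡 n).tangent 𝓘(ℝ, ℝ) ∞ F (slit n M))
    (h0 : c ≠ 0) :
    CondA S ↔ ∀ p ∈ slit n M, Module.finrank ℝ (LinearMap.range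
      (fderiv ℝ (fderiv ℝ (fun y : EuclideanSpace ℝ (Fin n) =>
        F (fibreIncl p.1 y) ^ 2 / 2)) p.2).toLinearMap) = n := by
  refine forall₂_congr fun p hp => ?_
  have hq := mem_extChartAt_source (I := (𝓡 n).tangent) p
  rw [formRank_extDer_iff hq (smoothNear_ricci_of_eq hc hF hq hp), rank_metric_iff hF hp]
  have hL := smoothNear_repf hq hp (contMDiffOn_sq hF)
  rw [(fderiv_repf_ricci hc hF hq hp).fderiv_eq, fderiv_fun_const_smul hL.fderiv.differentiableAt]
  simp [h0]

/-- After substituting Ric = (n−1)κF², (D1) is 2(n−1) times the flag curvature equation. -/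
theorem condD1_iff {c : ℝ} (hc : ∀ p ∈ slit n M, ricci S p = c * F p ^ 2)
    (hF : ContMDiffOn (𝓡 n).tangent 𝓘(ℝ, ℝ) ∞ F (slit n M))
    (hn : 2 ≤ n) {κ : ℝ} (hκ : c = ((n : ℝ) - 1) * κ) :
    CondD1 S ↔ HasConstantFlagCurvature F S κ := by
  rw [hasConstantFlagCurvature_iff hF]
  refine forall₂_congr fun p hp => forall_congr' fun w => ?_
  have hq := mem_extChartAt_source (I := (𝓡 n).tangent) p
  have hn' : (n : ℝ) - 1 ≠ 0 := by
    have : (2 : ℝ) ≤ n := by exact_mod_cast hn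
    linarith
  have e : dJ (ricci S) p w = c * dJ (fun q => F q ^ 2) p w := by
    rw [dJ_eq hq (smoothNear_ricci_of_eq hc hF hq hp),
      dJ_eq hq (smoothNear_repf hq hp (contMDiffOn_sq hF)),
      (fderiv_repf_ricci hc hF hq hp).self_of_nhds]
    rfl
  rw [e, hc p hp, hκ]
  generalize evalAt (jacobi S) p w = a
  generalize tangentStr p w = b
  generalize liouville p = d
  have e2 : (2 * ((n : ℝ) - 1)) • a - (2 * (((n : ℝ) - 1) * κ * F p ^ 2)) • b +
      (((n : ℝ) - 1) * κ * dJ (fun q => F q ^ 2) p w) • d =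
      (2 * ((n : ℝ) - 1)) • (a - κ • (F p ^ 2 • b - (dJ (fun q => F q ^ 2) p w / 2) • d)) := by
    module
  rw [e2, smul_eq_zero_iff_right (by simpa using hn'), sub_eq_zero]

/-- Condition (D2) says that `F²` is constant along the horizontal fields. -/
theorem condD2_iff {c : ℝ} (hc : ∀ p ∈ slit n M, ricci S p = c * F p ^ 2)
    (hF : ContMDiffOn (𝓡 n).tangent 𝓘(ℝ, ℝ) ∞ F (slit n M))
    (hS : IsSpray S) (h0 : c ≠ 0) :
    CondD2 S ↔ ∀ p₀ : TM n M, ∀ p ∈ (chartTM p₀).source, p ∈ slit n M → ∀ a,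
      fderiv ℝ (repf p₀ (fun q => F q ^ 2)) (chartTM p₀ p)
        (a, -conn (rep p₀ S) (chartTM p₀ p) a) = 0 := by
  have key : ∀ p₀ : TM n M, ∀ p ∈ (chartTM p₀).source, p ∈ slit n M → ∀ w : TTM n M p,
      (diff (ricci S) p (evalAt (hor S) p w) = 0 ↔
        fderiv ℝ (repf p₀ (fun q => F q ^ 2)) (chartTM p₀ p)
          ((dTot p₀ p w).1, -conn (rep p₀ S) (chartTM p₀ p) (dTot p₀ p w).1) = 0) := by
    intro p₀ p hq hp w
    rw [diff_eq hq (smoothNear_ricci_of_eq hc hF hq hp), dTot_hor hS hq hp,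
      (fderiv_repf_ricci hc hF hq hp).self_of_nhds, _root_.smul_apply,
      smul_eq_zero_iff_right h0]
  constructor
  · intro h p₀ p hq hp a
    obtain ⟨w, hw⟩ := dTot_surjective hq (a, 0)
    have := (key p₀ p hq hp w).1 (h p hp w)
    rwa [hw] at this
  · intro h p hp w
    have hq := mem_extChartAt_source (I := (𝓡 n).tangent) p
    exact (key p p hq hp w).2 (h p p hq hp _)

theorem metrizes_iff (hS : IsSpray S)
    (hF : ContMDiffOn (𝓡 n).tangent 𝓘(ℝ, ℝ) ∞ F (slit n M))
    (hE : ∀ p₀ : TM n M, ∀ p ∈ (chartTM p₀).source, p ∈ slit n M →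
      fderiv ℝ (repf p₀ (fun q => F q ^ 2)) (chartTM p₀ p) (0, (chartTM p₀ p).2) = 2 * F p ^ 2) :
    Metrizes F S ↔ ∀ p₀ : TM n M, ∀ p ∈ (chartTM p₀).source, p ∈ slit n M → ∀ a,
      fderiv ℝ (repf p₀ (fun q => F q ^ 2)) (chartTM p₀ p)
        (a, -conn (rep p₀ S) (chartTM p₀ p) a) = 0 := by
  -- Euler's relation is needed on a neighbourhood, since it gets differentiated.
  have hE' : ∀ p₀ : TM n M, ∀ p ∈ (chartTM p₀).source, p ∈ slit n M → ∀ᶠ z in 𝓝 (chartTM p₀ p),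
      fderiv ℝ (repf p₀ (fun q => F q ^ 2)) z (0, z.2) = 2 * repf p₀ (fun q => F q ^ 2) z :=
    fun p₀ p hq hp => eventually_of_slit hq hp fun q' h1 h2 => by
      rw [hE p₀ q' h1 h2, repf_apply h1]
  have key : ∀ p₀ : TM n M, ∀ p ∈ (chartTM p₀).source, p ∈ slit n M → ∀ w : TTM n M p,
      (extDer (dJ (fun q => F q ^ 2)) p (S p) w = - diff (fun q => F q ^ 2) p w ↔
        twoForm (repf p₀ (fun q => F q ^ 2)) (chartTM p₀ p) (rep p₀ S (chartTM p₀ p))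
          (dTot p₀ p w) = -fderiv ℝ (repf p₀ (fun q => F q ^ 2)) (chartTM p₀ p) (dTot p₀ p w)) := by
    intro p₀ p hq hp w
    have hL := smoothNear_repf hq hp (contMDiffOn_sq hF)
    rw [diff_eq hq hL, extDer_dJ hq hL, rep_apply hq]
  constructor
  · intro h p₀ p hq hp a
    refine horizontal_of_twoForm_spray (hS.smoothNear hq hp) (hS.isSecondOrder hq hp)
      (smoothNear_repf hq hp (contMDiffOn_sq hF)) (hE' p₀ p hq hp)
      (eventually_of_slit hq hp fun q' h1 h2 u => ?_) a
    obtain ⟨w, rfl⟩ := dTot_surjective h1 u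
    exact (key p₀ q' h1 h2 w).1 (h q' h2 w)
  · intro h p hp w
    have hq := mem_extChartAt_source (I := (𝓡 n).tangent) p
    exact (key p p hq hp w).2 (twoForm_spray_of_horizontal (hS.smoothNear hq hp)
      (hS.isSecondOrder hq hp) (eventually_of_slit hq hp fun q' h1 h2 => hS.rep_eq h1 h2)
      (smoothNear_repf hq hp (contMDiffOn_sq hF)) (hE' p p hq hp)
      (eventually_of_slit hq hp fun q' h1 h2 => h p q' h1 h2) _)

end SprayGeometry

namespace SprayGeometry

open ChartRep SprayCoord VectorField

variable {n : ℕ} {M : Type*} [TopologicalSpace M] [ChartedSpace (EuclideanSpace ℝ (Fin n)) M]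
  [IsManifold (𝓡 n) ∞ M] {p₀ q : TM n M} {S : VField n M} {f F : TM n M → ℝ}

/-! ### Homogeneity -/

/-- The homothety of ratio `t` of the fibres of `TM`. -/
def scale (t : ℝ) (q : TM n M) : TM n M := ⟨q.1, t • q.2⟩

theorem scale_mem_source (hq : q ∈ (chartTM p₀).source) (t : ℝ) :
    scale t q ∈ (chartTM p₀).source :=
  mem_chartTM_source.2 (mem_chartTM_source.1 hq)

theorem chartTM_scale (hq : q ∈ (chartTM p₀).source) (t : ℝ) :
    chartTM p₀ (scale t q) = ((chartTM p₀ q).1, t • (chartTM p₀ q).2) := by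
  rw [chartTM_apply hq, chartTM_apply (scale_mem_source hq t)]
  exact Prod.ext rfl (map_smul (dBase p₀ q) t q.2)

set_option linter.unusedSectionVars false in
theorem scale_mem_slit (hs : q ∈ slit n M) {t : ℝ} (ht : t ≠ 0) : scale t q ∈ slit n M :=
  smul_ne_zero (M := EuclideanSpace ℝ (Fin n)) ht hs

/-- The maps y ↦ eˢy form the flow of ℂ, so the derivative in s is ℂ(f) at the moving point. -/
theorem hasDerivAt_scale_exp (hq : q ∈ (chartTM p₀).source) (hs : q ∈ slit n M)
    (hf : ContMDiffOn (𝓡 n).tangent 𝓘(ℝ, ℝ) ∞ f (slit n M)) (s : ℝ) :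
    HasDerivAt (fun s => f (scale (Real.exp s) q))
      (fderiv ℝ (repf p₀ f) (chartTM p₀ (scale (Real.exp s) q))
        (0, (chartTM p₀ (scale (Real.exp s) q)).2)) s := by
  have e1 := scale_mem_source hq (Real.exp s)
  have e2 := scale_mem_slit hs (Real.exp_pos s).ne'
  have h1 := (smoothNear_repf e1 e2 hf).differentiableAt.hasFDerivAt
  rw [chartTM_scale hq] at h1 ⊢
  have h2 : HasDerivAt (fun s => ((chartTM p₀ q).1, Real.exp s • (chartTM p₀ q).2))
      (0, Real.exp s • (chartTM p₀ q).2) s :=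
    (hasDerivAt_const s _).prodMk ((Real.hasDerivAt_exp s).smul_const _)
  have h3 := h1.comp_hasDerivAt s h2
  refine h3.congr_of_eventuallyEq (Filter.Eventually.of_forall fun t => ?_)
  have := repf_apply (scale_mem_source hq (Real.exp t)) f
  rw [chartTM_scale hq] at this
  exact this.symm

/-- Euler's relation for a `2`-homogeneous function. -/
theorem euler_of_homogeneous (hf : ContMDiffOn (𝓡 n).tangent 𝓘(ℝ, ℝ) ∞ f (slit n M))
    (hh : ∀ q ∈ slit n M, ∀ t : ℝ, 0 < t → f (scale t q) = t ^ 2 * f q)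
    (hq : q ∈ (chartTM p₀).source) (hs : q ∈ slit n M) :
    fderiv ℝ (repf p₀ f) (chartTM p₀ q) (0, (chartTM p₀ q).2) = 2 * f q := by
  have h1 := hasDerivAt_scale_exp hq hs hf 0
  have h2 : HasDerivAt (fun s => f (scale (Real.exp s) q)) (2 * f q) 0 := by
    have e : (fun s => f (scale (Real.exp s) q)) = fun s => Real.exp s ^ 2 * f q := by
      funext s
      exact hh q hs _ (Real.exp_pos s)
    rw [e]
    convert! ((Real.hasDerivAt_exp 0).pow 2).mul_const (f q) using 1
    simp
  have e : scale (Real.exp 0) q = q := by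
    rw [Real.exp_zero, scale, one_smul]
  rw [e] at h1
  exact h1.unique h2

/-- Integration of Euler's relation along the rays. -/
theorem homogeneous_of_euler (hf : ContMDiffOn (𝓡 n).tangent 𝓘(ℝ, ℝ) ∞ f (slit n M))
    (hE : ∀ p₀ : TM n M, ∀ q ∈ (chartTM p₀).source, q ∈ slit n M →
      fderiv ℝ (repf p₀ f) (chartTM p₀ q) (0, (chartTM p₀ q).2) = 2 * f q)
    (hs : q ∈ slit n M) {t : ℝ} (ht : 0 < t) : f (scale t q) = t ^ 2 * f q := by
  have hq := mem_extChartAt_source (I := (𝓡 n).tangent) q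
  -- Along the flow, f multiplied by e⁻²ˢ is constant; comparing s = log t with s = 0 gives the
  -- claim.
  have hd : ∀ s, HasDerivAt (fun s => f (scale (Real.exp s) q) * Real.exp (-2 * s)) 0 s := by
    intro s
    have h1 := hasDerivAt_scale_exp hq hs hf s
    rw [hE _ _ (scale_mem_source hq _) (scale_mem_slit hs (Real.exp_pos s).ne')] at h1
    have h2 : HasDerivAt (fun s : ℝ => Real.exp (-2 * s)) (Real.exp (-2 * s) * (-2 * 1)) s :=
      ((hasDerivAt_id s).const_mul (-2)).exp
    convert! h1.mul h2 using 1
    ring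
  have hc := is_const_of_deriv_eq_zero (fun s => (hd s).differentiableAt) (fun s => (hd s).deriv)
    (Real.log t) 0
  rw [Real.exp_log ht, Real.exp_zero, mul_zero, Real.exp_zero, mul_one] at hc
  have e1 : scale 1 q = q := by rw [scale, one_smul]
  have e2 : Real.exp (-2 * Real.log t) * t ^ 2 = 1 := by
    rw [← Real.exp_log (pow_pos ht 2), ← Real.exp_add, Real.log_pow]
    simp
  rw [e1] at hc
  rw [← hc]
  linear_combination (-f (scale t q)) * e2

/-- A `1`-homogeneous function that is continuous on `T₀M` is continuous. -/
theorem continuous_of_homogeneous (hF : ContMDiffOn (𝓡 n).tangent 𝓘(ℝ, ℝ) ∞ F (slit n M))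
    (hh : ∀ q, ∀ t : ℝ, 0 ≤ t → F (scale t q) = t * F q) : Continuous F := by
  rw [continuous_iff_continuousAt]
  intro q
  by_cases hs : q ∈ slit n M
  · exact (hF.continuousOn.continuousAt (isOpen_slit.mem_nhds hs))
  have hq := mem_extChartAt_source (I := (𝓡 n).tangent) q
  have hFq : ∀ q : TM n M, q ∉ slit n M → F q = 0 := by
    intro q hs
    have h0 : q.2 = 0 := not_not.1 hs
    have e : scale 0 q = q := by rw [scale, zero_smul, ← h0]
    rw [← e, hh q 0 le_rfl, zero_mul]
  obtain ⟨r, hr, hball⟩ : ∃ r > 0, Metric.closedBall (chartTM q q) r ⊆ (chartTM q).target :=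
    Metric.nhds_basis_closedBall.mem_iff.1 (chartTM_target_mem_nhds hq)
  -- The target of a chart of TM is a full cylinder: membership depends on x alone.
  have htarget : ∀ x ∈ Metric.closedBall (chartTM q q).1 r, ∀ y, (x, y) ∈ (chartTM q).target := by
    intro x hx y
    have h1 : (x, (chartTM q q).2) ∈ (chartTM q).target := by
      refine hball ?_
      rw [Metric.mem_closedBall, Prod.dist_eq, dist_self]
      exact max_le hx hr.le
    rw [extChartAt_target] at h1 ⊢
    simp only [ModelWithCorners.range_eq_univ, Set.inter_univ, Set.mem_preimage] at h1 ⊢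
    exact h1
  have hcont : ContinuousOn (repf q F) (Metric.closedBall (chartTM q q).1 r ×ˢ
      Metric.sphere (0 : EuclideanSpace ℝ (Fin n)) 1) := by
    rintro ⟨x, y⟩ ⟨hx, hy⟩
    have ht := htarget x hx y
    have h1 := (chartTM q).map_target ht
    have h2 := (chartTM q).right_inv ht
    have h3 : (chartTM q).symm (x, y) ∈ slit n M := by
      rw [mem_slit_iff h1, h2]
      rintro rfl
      simp at hy
    have h4 := (smoothNear_repf h1 h3 hF).differentiableAt.continuousAt
    rw [h2] at h4
    exact h4.continuousWithinAt
  obtain ⟨C, hC⟩ := ((isCompact_closedBall _ _).prod (isCompact_sphere _ _)).exists_bound_of_continuousOn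
    hcont
  -- Homogeneity extends the bound from the compact set (ball) × (unit sphere) to |F| ≤ C‖y‖, which
  -- tends to zero at the zero section.
  have hbound : ∀ᶠ q' in 𝓝 q, ‖F q'‖ ≤ C * ‖(chartTM q q').2‖ := by
    have h1 : ContinuousAt (fun q' => (chartTM q q').1) q :=
      (continuousAt_extChartAt (I := (𝓡 n).tangent) q).fst
    filter_upwards [extChartAt_source_mem_nhds (I := (𝓡 n).tangent) q,
      h1 (Metric.closedBall_mem_nhds _ hr)] with q' hq' hx
    by_cases hs' : q' ∈ slit n M
    · have hy := (mem_slit_iff hq').1 hs'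
      have hy' := norm_pos_iff.2 hy
      have e1 : q' = scale ‖(chartTM q q').2‖ (scale ‖(chartTM q q').2‖⁻¹ q') := by
        rw [scale, scale, smul_smul, mul_inv_cancel₀ hy'.ne', one_smul]
      have e2 := hC (chartTM q (scale ‖(chartTM q q').2‖⁻¹ q')) (by
        rw [chartTM_scale hq']
        refine ⟨hx, ?_⟩
        rw [mem_sphere_zero_iff_norm, norm_smul, norm_inv, norm_norm, inv_mul_cancel₀ hy'.ne'])
      rw [repf_apply (scale_mem_source hq' _)] at e2
      conv_lhs => rw [e1, hh _ _ hy'.le, norm_mul, norm_norm, mul_comm]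
      exact mul_le_mul_of_nonneg_right e2 hy'.le
    · have h0 : (chartTM q q').2 = 0 := not_not.1 fun h => hs' ((mem_slit_iff hq').2 h)
      rw [hFq q' hs', h0, norm_zero, norm_zero, mul_zero]
  have h2 : ContinuousAt (fun q' => C * ‖(chartTM q q').2‖) q :=
    continuousAt_const.mul (continuousAt_extChartAt (I := (𝓡 n).tangent) q).snd.norm
  have h0 : (chartTM q q).2 = 0 := not_not.1 fun h => hs ((mem_slit_iff hq).2 h)
  rw [ContinuousAt, h0, norm_zero, mul_zero] at h2
  rw [ContinuousAt, hFq q hs]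
  exact squeeze_zero_norm' hbound h2

/-! ### The Ricci curvature -/

/-- The identity has trace n, and the rank-one map β ⊗ y has trace β(y), here the Liouville
derivative ℂ(f). -/
theorem ricci_eq_of_jacobi (hq : q ∈ (chartTM p₀).source)
    (hf : SmoothNear (repf p₀ f) (chartTM p₀ q)) {α γ : ℝ}
    (h : ∀ w, evalAt (jacobi S) q w = α • tangentStr q w - (γ * dJ f q w) • liouville q) :
    ricci S q =
      α * n - γ * fderiv ℝ (repf p₀ f) (chartTM p₀ q) (0, (chartTM p₀ q).2) := by
  let β : EuclideanSpace ℝ (Fin n) →ₗ[ℝ] ℝ :=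
    (fderiv ℝ (repf p₀ f) (chartTM p₀ q)).toLinearMap.comp (LinearMap.inr ℝ _ _)
  have h1 : ricci S q = LinearMap.trace ℝ _
      (α • LinearMap.id - γ • β.smulRight (chartTM p₀ q).2) := by
    refine semibasicTrace_eq_trace hq fun w => ?_
    rw [h, map_sub, map_smul, map_smul, dTot_tangentStr hq, dTot_liouville hq, dJ_eq hq hf]
    refine Prod.ext (by simp) ?_
    simp [β, smul_smul]
  rw [h1, map_sub, map_smul, map_smul, LinearMap.trace_id, LinearMap.trace_smulRight,
    finrank_euclideanSpace_fin]
  rfl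

/-- Condition (D1) forces the Ricci curvature to be `2`-homogeneous. -/
theorem CondD1.euler (hn : 2 ≤ n) (hS : IsSpray S) (h : CondD1 S)
    (hq : q ∈ (chartTM p₀).source) (hs : q ∈ slit n M) :
    fderiv ℝ (repf p₀ (ricci S)) (chartTM p₀ q) (0, (chartTM p₀ q).2) = 2 * ricci S q := by
  have hn' : (n : ℝ) - 1 ≠ 0 := by
    have : (2 : ℝ) ≤ n := by exact_mod_cast hn
    linarith
  -- These coefficients come from solving (D1) for Φ. The trace then reads Ric = (n Ric −
  -- ½ℂ(Ric))/(n−1), that is, ℂ(Ric) = 2 Ric.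
  have h1 := ricci_eq_of_jacobi (α := ricci S q / ((n : ℝ) - 1)) (γ := 1 / (2 * ((n : ℝ) - 1)))
    hq (smoothNear_ricci hS hq hs) fun w => by
      have e := h q hs w
      refine smul_right_injective (TTM n M q) (mul_ne_zero two_ne_zero hn') ?_
      beta_reduce
      have e1 : 2 * ((n : ℝ) - 1) * (ricci S q / ((n : ℝ) - 1)) = 2 * ricci S q := by field_simp
      have e2 : 2 * ((n : ℝ) - 1) * (1 / (2 * ((n : ℝ) - 1)) * dJ (ricci S) q w) =
          dJ (ricci S) q w := by field_simp
      rw [smul_sub, smul_smul, smul_smul, e1, e2]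
      rw [sub_add_eq_add_sub, sub_eq_zero] at e
      exact eq_sub_of_add_eq e
  field_simp at h1
  linarith

/-- The Ricci curvature of a metric of constant flag curvature. -/
theorem IsFinsler.ricci_eq (hF : IsFinsler F) {κ : ℝ} (h : HasConstantFlagCurvature F S κ)
    (hs : q ∈ slit n M) : ricci S q = ((n : ℝ) - 1) * κ * F q ^ 2 := by
  have hq := mem_extChartAt_source (I := (𝓡 n).tangent) q
  have hh : ∀ q ∈ slit n M, ∀ t : ℝ, 0 < t → F (scale t q) ^ 2 = t ^ 2 * F q ^ 2 := by
    intro q _ t ht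
    rw [scale, hF.homogeneous q.1 q.2 t ht.le, mul_pow]
  -- The factor κ/2 comes from F d_J F = ½ d_J F².
  have h1 := ricci_eq_of_jacobi (S := S) (α := κ * F q ^ 2) (γ := κ / 2) hq
    (smoothNear_repf hq hs (contMDiffOn_sq hF.smooth)) fun w => by
      rw [(hasConstantFlagCurvature_iff hF.smooth).1 h q hs w, smul_sub, smul_smul, smul_smul]
      ring_nf
  rw [h1, euler_of_homogeneous (contMDiffOn_sq hF.smooth) hh hq hs]
  ring

/-! ### Sign of a function on `T₀M` -/

/-- For n ≥ 2 a punctured fibre is connected, so the sign is constant on each fibre and descends to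
M. The projection is open, so the base points of positive and of negative sign form two
complementary open sets, and one of them is empty. -/
theorem pos_or_neg_of_ne_zero [PreconnectedSpace M] (hn : 2 ≤ n)
    (hf : ContinuousOn f (slit n M)) (h0 : ∀ p ∈ slit n M, f p ≠ 0) :
    (∀ p ∈ slit n M, 0 < f p) ∨ ∀ p ∈ slit n M, f p < 0 := by
  have hrank : 1 < Module.rank ℝ (EuclideanSpace ℝ (Fin n)) := by
    rw [← Module.finrank_eq_rank, finrank_euclideanSpace_fin]
    exact_mod_cast hn
  have : Nontrivial (EuclideanSpace ℝ (Fin n)) := by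
    rw [← rank_pos_iff_nontrivial (R := ℝ)]
    exact zero_lt_one.trans hrank
  have hopen : ∀ s : Set ℝ, IsOpen s →
      IsOpen ((fun p : TM n M => p.1) '' (slit n M ∩ f ⁻¹' s)) := fun s hs =>
    FiberBundle.isOpenMap_proj (F := EuclideanSpace ℝ (Fin n)) (TangentSpace (𝓡 n)) _
      (hf.isOpen_inter_preimage isOpen_slit hs)
  have hfib : ∀ p p' : TM n M, p ∈ slit n M → p' ∈ slit n M → p.1 = p'.1 → 0 < f p → 0 < f p' := by
    rintro ⟨x, y⟩ ⟨x', y'⟩ hp hp' rfl hpos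
    have hc : ContinuousOn (fun y => f (fibreIncl x y)) {(0 : EuclideanSpace ℝ (Fin n))}ᶜ :=
      hf.comp (fun y _ => (contMDiffAt_fibreIncl x y).continuousAt.continuousWithinAt)
        fun y hy => hy
    have himg := (isConnected_compl_singleton_of_one_lt_rank hrank
      (0 : EuclideanSpace ℝ (Fin n))).isPreconnected.image _ hc
    by_contra hneg
    obtain ⟨z, hz, hz0⟩ := himg.ordConnected.out (Set.mem_image_of_mem _ hp')
      (Set.mem_image_of_mem _ hp) (⟨not_lt.1 hneg, hpos.le⟩ : (0 : ℝ) ∈ Set.Icc _ _)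
    exact h0 (fibreIncl x z) hz hz0
  set U := (fun p : TM n M => p.1) '' (slit n M ∩ f ⁻¹' Set.Ioi 0) with hU
  -- Punctured fibres are nonempty, so every base point has a sign; constancy on fibres makes the
  -- two sets disjoint.
  have hUc : Uᶜ = (fun p : TM n M => p.1) '' (slit n M ∩ f ⁻¹' Set.Iio 0) := by
    ext x
    constructor
    · intro hx
      obtain ⟨y, hy⟩ := exists_ne (0 : EuclideanSpace ℝ (Fin n))
      have hs : fibreIncl x y ∈ slit n M := hy
      refine ⟨fibreIncl x y, ⟨hs, lt_of_le_of_ne (not_lt.1 fun h => hx ?_) (h0 _ hs)⟩, rfl⟩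
      exact ⟨fibreIncl x y, ⟨hs, h⟩, rfl⟩
    · rintro ⟨p, ⟨hs, hlt⟩, rfl⟩ ⟨p', ⟨hs', hgt⟩, he⟩
      exact lt_asymm (hfib p' p hs' hs he hgt) hlt
  have hclopen : IsClopen U := by
    refine ⟨isOpen_compl_iff.1 ?_, hopen _ isOpen_Ioi⟩
    rw [hUc]
    exact hopen _ isOpen_Iio
  rcases isClopen_iff.1 hclopen with h | h
  · right
    intro p hs
    refine lt_of_le_of_ne (not_lt.1 fun hlt => ?_) (h0 p hs)
    have : p.1 ∈ U := ⟨p, ⟨hs, hlt⟩, rfl⟩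
    rw [h] at this
    exact this
  · left
    intro p hs
    obtain ⟨p', ⟨hs', hgt⟩, he⟩ : p.1 ∈ U := by rw [h]; trivial
    exact hfib p' p hs' hs he hgt

end SprayGeometry

/-! ### The two directions of the theorem -/

namespace SprayGeometry

variable {n : ℕ} {M : Type*} [TopologicalSpace M] [ChartedSpace (EuclideanSpace ℝ (Fin n)) M]
  [IsManifold (𝓡 n) ∞ M] {p₀ q : TM n M} {S : VField n M} {f F : TM n M → ℝ}

theorem IsFinsler.euler (hF : IsFinsler F) (p₀ : TM n M) (q : TM n M)
    (hq : q ∈ (chartTM p₀).source) (hs : q ∈ slit n M) :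
    fderiv ℝ (repf p₀ (fun q => F q ^ 2)) (chartTM p₀ q) (0, (chartTM p₀ q).2) = 2 * F q ^ 2 :=
  euler_of_homogeneous (contMDiffOn_sq hF.smooth)
    (fun q _ t ht => by rw [scale, hF.homogeneous q.1 q.2 t ht.le, mul_pow]) hq hs

/-- A metrizable spray of nonzero constant flag curvature satisfies (A), (D1) and (D2). -/
theorem conditions_of_constantFlagCurvature (hn : 2 ≤ n) (hS : IsSpray S) (hF : IsFinsler F)
    (hM : Metrizes F S) {κ : ℝ} (hκ : κ ≠ 0) (hC : HasConstantFlagCurvature F S κ) :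
    CondA S ∧ CondD1 S ∧ CondD2 S := by
  have hn' : (n : ℝ) - 1 ≠ 0 := by
    have : (2 : ℝ) ≤ n := by exact_mod_cast hn
    linarith
  have hc : ∀ p ∈ slit n M, ricci S p = (((n : ℝ) - 1) * κ) * F p ^ 2 := fun p hp =>
    hF.ricci_eq hC hp
  exact ⟨(condA_iff hc hF.smooth (mul_ne_zero hn' hκ)).2 hF.rank_metric,
    (condD1_iff hc hF.smooth hn rfl).2 hC,
    (condD2_iff hc hF.smooth hS (mul_ne_zero hn' hκ)).2
      ((metrizes_iff hS hF.smooth hF.euler).1 hM)⟩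

/-- If `σ R` is positive, `σ = ± 1`, then `√(σ R)` is a Finsler function of constant flag
curvature `σ` which metrizes the spray. -/
theorem finsler_of_conditions (hn : 2 ≤ n) (hS : IsSpray S) {σ : ℝ} (hσ : σ * σ = 1)
    (hpos : ∀ p ∈ slit n M, 0 < σ * ricciScalar S p)
    (hA : CondA S) (hD1 : CondD1 S) (hD2 : CondD2 S) :
    ∃ F : TM n M → ℝ, (∀ p ∈ slit n M, F p ^ 2 = σ * ricciScalar S p) ∧
      IsFinsler F ∧ Metrizes F S ∧ HasConstantFlagCurvature F S σ := by
  classical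
  have hn' : (n : ℝ) - 1 ≠ 0 := by
    have : (2 : ℝ) ≤ n := by exact_mod_cast hn
    linarith
  have hσ0 : σ ≠ 0 := fun h => by simp [h] at hσ
  -- Homogeneity at t = 0 forces the value 0 on the zero section, where nothing is known about R.
  let F : TM n M → ℝ := fun p => if p ∈ slit n M then √(σ * ricciScalar S p) else 0
  have hFs : ∀ p ∈ slit n M, F p = √(σ * ricciScalar S p) := fun p hp => if_pos hp
  have hF0 : ∀ p ∉ slit n M, F p = 0 := fun p hp => if_neg hp
  have hsq : ∀ p ∈ slit n M, F p ^ 2 = σ * ricciScalar S p := fun p hp => by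
    rw [hFs p hp, Real.sq_sqrt (hpos p hp).le]
  have hsmooth : ContMDiffOn (𝓡 n).tangent 𝓘(ℝ, ℝ) ∞ F (slit n M) := by
    intro p hp
    have h1 : ContDiffAt ℝ ∞ (fun x : ℝ => √(σ * (x / ((n : ℝ) - 1)))) (ricci S p) :=
      (contDiffAt_const.mul (contDiffAt_id.div_const _)).sqrt (hpos p hp).ne'
    exact (h1.contMDiffAt.comp_contMDiffWithinAt p (contMDiffOn_ricci hS p hp)).congr hFs
      (hFs p hp)
  -- As σ² = 1, the relation F² = σR inverts to R = σF².
  have hc : ∀ p ∈ slit n M, ricci S p = (((n : ℝ) - 1) * σ) * F p ^ 2 := fun p hp => by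
    rw [hsq p hp, ricciScalar]
    field_simp
    linear_combination (-ricci S p) * hσ
  have hhom : ∀ q : TM n M, ∀ t : ℝ, 0 ≤ t → F (scale t q) = t * F q := by
    intro q t ht
    by_cases hq : q ∈ slit n M
    · rcases ht.eq_or_lt with rfl | ht
      · rw [zero_mul]
        exact hF0 _ fun h => h (zero_smul ℝ q.2)
      · rw [hFs _ (scale_mem_slit hq ht.ne'), hFs q hq, ricciScalar, ricciScalar,
          homogeneous_of_euler (contMDiffOn_ricci hS)
            (fun p₀ q hq hs => hD1.euler hn hS hq hs) hq ht, mul_div_assoc, mul_left_comm,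
          Real.sqrt_mul (sq_nonneg t), Real.sqrt_sq ht.le]
    · have h0 : q.2 = 0 := not_not.1 hq
      have e : scale t q ∉ slit n M := fun h => h (by
        change t • q.2 = 0
        rw [h0, smul_zero])
      rw [hF0 _ e, hF0 q hq, mul_zero]
  have hFin : IsFinsler F :=
    { continuous := continuous_of_homogeneous hsmooth hhom
      smooth := hsmooth
      pos := fun p hp => by rw [hFs p hp]; exact Real.sqrt_pos.2 (hpos p hp)
      homogeneous := fun x y t ht => hhom ⟨x, y⟩ t ht
      rank_metric := (condA_iff hc hsmooth (mul_ne_zero hn' hσ0)).1 hA }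
  exact ⟨F, hsq, hFin,
    (metrizes_iff hS hsmooth hFin.euler).2
      ((condD2_iff hc hsmooth hS (mul_ne_zero hn' hσ0)).1 hD2),
    (condD1_iff hc hsmooth hn rfl).1 hD1⟩

/-- The constant sign of R supplies σ = ±1, for which σR = |R|; this σ is the flag curvature. -/
theorem finsler_of_conditions_of_connected [PreconnectedSpace M] (hn : 2 ≤ n) (hS : IsSpray S)
    (hRic : ∀ p ∈ slit n M, ricci S p ≠ 0) (h : CondA S ∧ CondD1 S ∧ CondD2 S) :
    ∃ (F : TM n M → ℝ) (κ : ℝ), κ ≠ 0 ∧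
      (∀ p ∈ slit n M, F p ^ 2 = |ricciScalar S p|) ∧
      (∀ p ∈ slit n M, κ = Real.sign (ricciScalar S p)) ∧
      IsFinsler F ∧ Metrizes F S ∧ HasConstantFlagCurvature F S κ := by
  have hn' : 0 < (n : ℝ) - 1 := by
    have : (2 : ℝ) ≤ n := by exact_mod_cast hn
    linarith
  obtain ⟨hA, hD1, hD2⟩ := h
  rcases pos_or_neg_of_ne_zero hn (contMDiffOn_ricci hS).continuousOn hRic with hp | hp
  · have hR : ∀ p ∈ slit n M, 0 < ricciScalar S p := fun p h => div_pos (hp p h) hn'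
    obtain ⟨F, h1, h2⟩ := finsler_of_conditions hn hS (one_mul 1)
      (fun p h => by rw [one_mul]; exact hR p h) hA hD1 hD2
    exact ⟨F, 1, one_ne_zero, fun p h => by rw [h1 p h, one_mul, abs_of_pos (hR p h)],
      fun p h => (Real.sign_of_pos (hR p h)).symm, h2⟩
  · have hR : ∀ p ∈ slit n M, ricciScalar S p < 0 := fun p h => div_neg_of_neg_of_pos (hp p h) hn'
    obtain ⟨F, h1, h2⟩ := finsler_of_conditions hn hS (σ := -1) (by norm_num)
      (fun p h => by rw [neg_one_mul]; exact neg_pos.2 (hR p h)) hA hD1 hD2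
    exact ⟨F, -1, by norm_num, fun p h => by rw [h1 p h, neg_one_mul, abs_of_neg (hR p h)],
      fun p h => (Real.sign_of_neg (hR p h)).symm, h2⟩

end SprayGeometry

end

theorem theorem4p1 (n : ℕ) (hn : 2 ≤ n) {M : Type*} [TopologicalSpace M] [T2Space M]
    [SecondCountableTopology M] [ConnectedSpace M]
    [ChartedSpace (EuclideanSpace ℝ (Fin n)) M] [IsManifold (𝓡 n) ∞ M]
    (S : SprayGeometry.VField n M) (hS : SprayGeometry.IsSpray S)
    (hRic : ∀ p ∈ SprayGeometry.slit n M, SprayGeometry.ricci S p ≠ 0) :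
    ((∃ F : SprayGeometry.TM n M → ℝ, SprayGeometry.IsFinsler F ∧ SprayGeometry.Metrizes F S ∧
        ∃ κ : ℝ, κ ≠ 0 ∧ SprayGeometry.HasConstantFlagCurvature F S κ) ↔
      (SprayGeometry.CondA S ∧ SprayGeometry.CondD1 S ∧ SprayGeometry.CondD2 S)) ∧
    ((SprayGeometry.CondA S ∧ SprayGeometry.CondD1 S ∧ SprayGeometry.CondD2 S) →
      ∃ (F : SprayGeometry.TM n M → ℝ) (κ : ℝ),
        (∀ p ∈ SprayGeometry.slit n M, F p ^ 2 = |SprayGeometry.ricciScalar S p|) ∧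
        (∀ p ∈ SprayGeometry.slit n M, κ = Real.sign (SprayGeometry.ricciScalar S p)) ∧
        SprayGeometry.IsFinsler F ∧ SprayGeometry.Metrizes F S ∧
        SprayGeometry.HasConstantFlagCurvature F S κ) := by
  constructor
  · constructor
    · rintro ⟨F, hF, hM, κ, hκ, hC⟩
      exact SprayGeometry.conditions_of_constantFlagCurvature hn hS hF hM hκ hC
    · intro h
      obtain ⟨F, κ, hκ, -, -, hF, hM, hC⟩ :=
        SprayGeometry.finsler_of_conditions_of_connected hn hS hRic h
      exact ⟨F, hF, hM, κ, hκ, hC⟩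
  · intro h
    obtain ⟨F, κ, -, h1⟩ := SprayGeometry.finsler_of_conditions_of_connected hn hS hRic h
    exact ⟨F, κ, h1⟩
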